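/- Let $d\ge 2$. For a vector field $a$ on $\mathbb R^d$ write $e^{t\Delta}a(x)=(4\pi t)^{-d/2}\int_{\mathbb R^d} e^{-|x-y|^2/(4t)}a(y)\,dy$ for $t>0$, and let $$F_{j;h,k}(x,t)=\int_{\mathbb R^d} i\,e^{-t|\xi|^2+ix\cdot\xi}\Bigl(\tfrac12\bigl[\xi_h\delta_{j,k}+\xi_k\delta_{j,h}\bigr]-\frac{\xi_j\xi_h\xi_k}{|\xi|^2}\Bigr)\frac{d\xi}{(2\pi)^d}$$ be the kernel of $e^{t\Delta}\mathbb P\,\mathrm{div}$, where $\mathbb P=1-\nabla\Delta^{-1}\mathrm{div}$ is the Leray projector. A global solution $u$ of the Navier–Stokes equations on $[0,\infty)\times\mathbb R^d$ with divergence-free initial datum $a=u(\cdot,0)$ means a mild solution: $u$ is measurable, bounded on $[0,T]\times\mathbb R^d$ for every $T<\infty$, and for $t>0$ $$u_j(t)=e^{t\Delta}a_j-\sum_{h,k=1}^d\int_0^t F_{j;h,k}(t-s)*(u_hu_k)(s)\,ds ,\qquad 1\le j\le d .$$ **Theorem.** Let $\vartheta>\frac{d+1}{2}$, and let $u$ be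 a global solution of the Navier–Stokes equations with initial datum $a$ such that $$|u(x,t)|\le C_0\,(1+|x|)^{-\alpha}(1+t)^{-\beta/2}$$ for all $t\ge 0$, almost all $x\in\mathbb R^d$ and all $\alpha,\beta\ge0$ with $\alpha+\beta\le\min\{\vartheta,d+1\}$. Put $$\Pi(x,t)=\gamma_d\sum_{h,k=1}^d\Bigl(\frac{\delta_{h,k}}{d\,|x|^d}-\frac{x_hx_k}{|x|^{d+2}}\Bigr)\int_0^t\!\!\int_{\mathbb R^d}(u_hu_k)(y,s)\,dy\,ds,\qquad \gamma_d=\pi^{-d/2}\,\Gamma\Bigl(\frac{d+2}{2}\Bigr).$$ Then there are functions $E$ and $\mathcal R$ such that for all $t>0$ and $x\neq0$ $$u(x,t)=e^{t\Delta}a(x)+\nabla\Pi(x,t)+|x|^{-d-1}E\Bigl(\frac{x}{\sqrt{t+1}};t\Bigr)+\mathcal R(x,t),$$ with the following estimates. First, for all $t>0$ and $x\in\mathbb R^d$, $$|E(x;t)|\le C\,e^{-c|x|^2}\int_0^t\|u(s)\|_{L^2(\mathbb R^d)}^2\,ds,$$ where $C,c>0$ depend only on $d$. Second, for every $0\le\alpha\le\min\{1,\vartheta-\frac{d+1}{2}\}$,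 all $t\ge1$ and all $x\ne0$: $$|\mathcal R(x,t)|\le C_\alpha\,|x|^{-d-1-\alpha}\,t^{-\frac12+\frac\alpha2}\qquad\text{if }\vartheta>\tfrac{d+3}{2},$$ $$|\mathcal R(x,t)|\le C_{\alpha,\epsilon}\,|x|^{-d-1-\alpha}\,t^{\frac{d+2+\alpha}{2}-\vartheta+\epsilon}\quad\text{for every }\epsilon>0,\qquad\text{if }\tfrac{d+1}{2}<\vartheta\le\tfrac{d+3}{2},$$ where $C_\alpha$ depends only on $d,\vartheta,C_0,\alpha$, and $C_{\alpha,\epsilon}$ only on $d,\vartheta,C_0,\alpha,\epsilon$. -/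

import Mathlib

open MeasureTheory

namespace NSProfile

noncomputable section

/-- `ℝ^d` with its Euclidean norm. -/
abbrev Space (d : ℕ) : Type := EuclideanSpace ℝ (Fin d)

/-- Kronecker symbol. -/
def kron {d : ℕ} (i j : Fin d) : ℝ := if i = j then 1 else 0

/-- `e^{tΔ} a (x) = (4πt)^{-d/2} ∫ e^{-|x-y|²/(4t)} a(y) dy`, for `t > 0`. -/
def heat {d : ℕ} (t : ℝ) (a : Space d → Space d) (x : Space d) : Space d :=
  (4 * Real.pi * t) ^ (-(d : ℝ) / 2) •
    ∫ y : Space d, Real.exp (-‖x - y‖ ^ 2 / (4 * t)) • a y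

/-- The symbol `½ (ξ_h δ_{jk} + ξ_k δ_{jh}) - ξ_j ξ_h ξ_k / |ξ|²`; multiplied by `i` it is the
(symmetrized) Fourier symbol of the operator `ℙ div`, where `ℙ = 1 - ∇ Δ⁻¹ div`. -/
def lerayDivSymbol {d : ℕ} (j h k : Fin d) (ξ : Space d) : ℝ :=
  1 / 2 * (ξ h * kron j k + ξ k * kron j h) - ξ j * ξ h * ξ k / ‖ξ‖ ^ 2

/-- The convolution kernel of the operator `e^{tΔ} ℙ div`, for `t > 0`:
`F_{j;h,k}(x,t) = ∫ i e^{-t|ξ|² + i x·ξ} (½ (ξ_h δ_{jk} + ξ_k δ_{jh}) - ξ_j ξ_h ξ_k/|ξ|²) dξ/(2π)^d`.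
The symbol is odd, so that the integral is a real number; `re` only changes its type. -/
def kernelF {d : ℕ} (j h k : Fin d) (x : Space d) (t : ℝ) : ℝ :=
  (((2 * Real.pi : ℂ) ^ d)⁻¹ * ∫ ξ : Space d,
    Complex.I * Complex.exp (-(t : ℂ) * (‖ξ‖ : ℂ) ^ 2 + Complex.I * (inner ℝ x ξ : ℝ)) *
      (lerayDivSymbol j h k ξ : ℂ)).re

/-- `div a = 0` in the sense of distributions. -/
def WeaklyDivFree {d : ℕ} (a : Space d → Space d) : Prop :=
  ∀ φ : Space d → ℝ, ContDiff ℝ (⊤ : ℕ∞) φ → HasCompactSupport φ →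
    ∫ x, inner ℝ (a x) (gradient φ x) = 0

/-- `u` (written `u t x`) is a global mild solution of the Navier--Stokes equations with initial
datum `a`: a measurable function on `[0,∞) × ℝ^d`, locally bounded in time with values in `L^∞`,
with divergence-free datum `u(0) = a`, and such that
`u(t) = e^{tΔ} a - ∫_0^t e^{(t-s)Δ} ℙ div (u ⊗ u)(s) ds` for `t > 0`.
For `t > 0` the right-hand side is a continuous function of `x`, and it is this representative of
`u(t)` that is used. -/
structure IsGlobalMildSolution {d : ℕ} (a : Space d → Space d) (u : ℝ → Space d → Space d) :
    Prop where
  measurable : Measurable fun p : NNReal × Space d => u (p.1 : ℝ) p.2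
  bounded : ∀ T : ℝ, ∃ M : ℝ, ∀ t : ℝ, 0 ≤ t → t ≤ T → ∀ᵐ x : Space d, ‖u t x‖ ≤ M
  initial : ∀ᵐ x : Space d, u 0 x = a x
  divFree : WeaklyDivFree a
  mild : ∀ t : ℝ, 0 < t → ∀ (x : Space d) (j : Fin d),
    u t x j = heat t a x j - ∑ h : Fin d, ∑ k : Fin d,
      ∫ s in (0 : ℝ)..t, ∫ y : Space d, kernelF j h k (x - y) (t - s) * (u s y h * u s y k)

/-- The matrix `K_{h,k}(t) = ∫_0^t ∫ u_h u_k (y,s) dy ds`. -/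
def energyMatrix {d : ℕ} (u : ℝ → Space d → Space d) (h k : Fin d) (t : ℝ) : ℝ :=
  ∫ s in (0 : ℝ)..t, ∫ y : Space d, u s y h * u s y k

/-- `‖u‖²_{L²([0,t], L²)}`. -/
def spaceTimeNormSq {d : ℕ} (u : ℝ → Space d → Space d) (t : ℝ) : ℝ :=
  ∫ s in (0 : ℝ)..t, ∫ y : Space d, ‖u s y‖ ^ 2

/-- `γ_d = π^{-d/2} Γ((d+2)/2)`. -/
def gammaConst (d : ℕ) : ℝ := Real.pi ^ (-(d : ℝ) / 2) * Real.Gamma (((d : ℝ) + 2) / 2)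

/-- `Π(x,t) = γ_d ∑_{h,k} (δ_{h,k} / (d |x|^d) - x_h x_k / |x|^{d+2}) K_{h,k}(t)`, for `x ≠ 0`. -/
def potential {d : ℕ} (u : ℝ → Space d → Space d) (x : Space d) (t : ℝ) : ℝ :=
  gammaConst d * ∑ h : Fin d, ∑ k : Fin d,
    (kron h k / ((d : ℝ) * ‖x‖ ^ d) - x h * x k / ‖x‖ ^ (d + 2)) * energyMatrix u h k t

end

end NSProfile

/-!
The integral equation writes `u - e^{tΔ}a` as minus the convolution, in space and time, of the
kernel `F` of `e^{tΔ} ℙ div` with `u_h u_k`. Away from the origin, to leading order, the function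
`(u_h u_k)(·,s)` acts as its integral times a Dirac mass, so that `F(x - y, t - s)` may be replaced
by `F(x, t - s)`.

The kernel is made explicit (`kernelF_eq`) by `|ξ|⁻² e^{-t|ξ|²} = ∫_t^∞ e^{-s|ξ|²} ds`: it is a first
derivative of the heat kernel at time `t` plus the integral over `s > t` of a third derivative of
the heat kernel at time `s`. Extending this integral to all `s > 0` gives the homogeneous function
`homKernel`, which is `∂_j ∂_h ∂_k` of the fundamental solution of `-Δ`. Contracted with the energy
matrix it produces `-∇Π` (`gradient_potential`), and the part of the integral that was added,
together with the first derivative, is `|x|^{-d-1}` times a Gaussian in `x/√t`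
(`exists_kernelF_sub_homKernel_bound`), which gives the profile `E` (`exists_norm_profileE_le`).

The remainder is the error of replacing `F(x - y)` by `F(x)`. The hypothesis on `u` says that
`|u_h u_k|(y,s) ≲ (√(1+s) + |y|)^{-2m}` with `m = min(ϑ, d+1)`. For `|y| ≤ |x|/2` the increment of the
kernel is at most `|y| |x|^{-d-1-α} (t-s)^{-(1-α)/2}`. For `|y| > |x|/2` the kernel at `x` obeys the same
bound, and the kernel at `x - y` is integrated in `y`, with `L¹` norm `(t-s)^{-1/2}`, against the decay
of `u_h u_k` (`abs_kernelF_sub_mul_le`). This leaves integrals `∫_0^t (t-s)^{-a} (1+s)^{-b} ds`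
(`exists_integral_sub_rpow_mul_le`); the first moment `∫ |y| |u|² dy` has `b = m - (d+1)/2`, which
exceeds `1` exactly when `ϑ > (d+3)/2`, whence the two regimes.
-/

namespace NSProfile

/-! ### Gaussian moments and their Fourier transforms -/

/-- Any power is absorbed by a Gaussian of arbitrarily small rate. -/
lemma exists_pow_le_exp_sq (n : ℕ) {δ : ℝ} (hδ : 0 < δ) :
    ∃ C : ℝ, 0 < C ∧ ∀ r : ℝ, 0 ≤ r → r ^ n ≤ C * Real.exp (δ * r ^ 2) := by
  refine ⟨n.factorial / δ ^ n * Real.exp δ, by positivity, fun r hr => ?_⟩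
  have h1 : (δ * (1 + r ^ 2)) ^ n / n.factorial ≤ Real.exp (δ * (1 + r ^ 2)) :=
    Real.pow_div_factorial_le_exp _ (by positivity) n
  have h2 : r ^ n ≤ (1 + r ^ 2) ^ n :=
    pow_le_pow_left₀ hr (by nlinarith [sq_nonneg (r - 1)]) n
  have h3 : Real.exp (δ * (1 + r ^ 2)) = Real.exp δ * Real.exp (δ * r ^ 2) := by
    rw [← Real.exp_add]; congr 1; ring
  rw [div_le_iff₀ (by positivity), mul_pow, h3] at h1
  rw [div_mul_eq_mul_div, div_mul_eq_mul_div, le_div_iff₀ (by positivity)]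
  calc r ^ n * δ ^ n ≤ (1 + r ^ 2) ^ n * δ ^ n := by gcongr
    _ = δ ^ n * (1 + r ^ 2) ^ n := by ring
    _ ≤ _ := h1.trans_eq (by ring)

lemma integrable_exp_neg_mul_norm_sq {d : ℕ} {s : ℝ} (hs : 0 < s) :
    Integrable fun ξ : Space d => Real.exp (-s * ‖ξ‖ ^ 2) := by
  have := (GaussianFourier.integrable_cexp_neg_mul_sq_norm_add (V := Space d) (b := (s : ℂ))
    (by simpa using hs) 0 0).norm
  refine this.congr (Filter.Eventually.of_forall fun ξ => ?_)
  simp only [zero_mul, add_zero, Complex.norm_exp]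
  congr 1
  norm_cast

lemma integrable_pow_mul_exp_neg_mul_norm_sq {d : ℕ} (n : ℕ) {s : ℝ} (hs : 0 < s) :
    Integrable fun ξ : Space d => ‖ξ‖ ^ n * Real.exp (-s * ‖ξ‖ ^ 2) := by
  obtain ⟨C, hC, h⟩ := exists_pow_le_exp_sq n (half_pos hs)
  refine ((integrable_exp_neg_mul_norm_sq (d := d) (half_pos hs)).const_mul C).mono'
    (by fun_prop) (Filter.Eventually.of_forall fun ξ => ?_)
  rw [Real.norm_of_nonneg (by positivity)]
  calc _ ≤ C * Real.exp (s / 2 * ‖ξ‖ ^ 2) * Real.exp (-s * ‖ξ‖ ^ 2) := by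
        gcongr; exact h _ (norm_nonneg _)
    _ = _ := by rw [mul_assoc, ← Real.exp_add]; congr 2; ring

/-- The integrand `e^{-s|ξ|² + i x·ξ}` of the inverse Fourier transform of the heat kernel. -/
noncomputable def gaussChar {d : ℕ} (s : ℝ) (x ξ : Space d) : ℂ :=
  Complex.exp (-(s : ℂ) * (‖ξ‖ : ℂ) ^ 2 + Complex.I * (inner ℝ x ξ : ℝ))

lemma norm_gaussChar {d : ℕ} (s : ℝ) (x ξ : Space d) :
    ‖gaussChar s x ξ‖ = Real.exp (-s * ‖ξ‖ ^ 2) := by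
  rw [gaussChar, Complex.norm_exp]
  congr 1
  have : (-(s : ℂ) * (‖ξ‖ : ℂ) ^ 2) = ((-s * ‖ξ‖ ^ 2 : ℝ) : ℂ) := by push_cast; ring
  rw [this, Complex.add_re, Complex.ofReal_re, mul_comm Complex.I, Complex.re_ofReal_mul]
  simp

lemma continuous_gaussChar {d : ℕ} (s : ℝ) (x : Space d) : Continuous (gaussChar s x) := by
  unfold gaussChar; fun_prop

lemma integrable_mul_gaussChar {d : ℕ} {P : Space d → ℂ} (hP : Continuous P) (n : ℕ)
    (hn : ∀ ξ, ‖P ξ‖ ≤ ‖ξ‖ ^ n) {s : ℝ} (hs : 0 < s) (x : Space d) :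
    Integrable fun ξ => P ξ * gaussChar s x ξ := by
  refine (integrable_pow_mul_exp_neg_mul_norm_sq n hs).mono'
    (hP.mul (continuous_gaussChar s x)).aestronglyMeasurable
    (Filter.Eventually.of_forall fun ξ => ?_)
  rw [norm_mul, norm_gaussChar]
  gcongr
  exact hn ξ

lemma abs_coord_le_norm {d : ℕ} (x : Space d) (j : Fin d) : |x j| ≤ ‖x‖ :=
  PiLp.norm_apply_le x j

lemma norm_coord_le {d : ℕ} (ξ : Space d) (j : Fin d) : ‖((ξ j : ℝ) : ℂ)‖ ≤ ‖ξ‖ := by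
  rw [Complex.norm_real]; exact abs_coord_le_norm ξ j

lemma hasFDerivAt_gaussChar {d : ℕ} (s : ℝ) (x ξ : Space d) :
    ∃ L : Space d →L[ℝ] ℂ, HasFDerivAt (gaussChar s x) L ξ ∧
      ∀ j, L (EuclideanSpace.single j 1) =
        (-2 * s * (ξ j : ℂ) + Complex.I * (x j : ℂ)) * gaussChar s x ξ := by
  have h1 : HasFDerivAt (fun ξ : Space d => ((‖ξ‖ ^ 2 : ℝ) : ℂ))
      (Complex.ofRealCLM.comp (2 • innerSL ℝ ξ)) ξ :=
    Complex.ofRealCLM.hasFDerivAt.comp ξ (hasStrictFDerivAt_norm_sq ξ).hasFDerivAt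
  have h2 : HasFDerivAt (fun ξ : Space d => ((inner ℝ x ξ : ℝ) : ℂ))
      (Complex.ofRealCLM.comp (innerSL ℝ x)) ξ :=
    Complex.ofRealCLM.hasFDerivAt.comp ξ (innerSL ℝ x).hasFDerivAt
  have h3 := ((h1.const_mul (-(s : ℂ))).add (h2.const_mul Complex.I)).cexp
  refine ⟨_, h3.congr_of_eventuallyEq (Filter.Eventually.of_forall fun ξ => ?_), fun j => ?_⟩
  · simp [gaussChar]
  · simp [gaussChar, EuclideanSpace.inner_single_right]
    ring

/-- Integration by parts against `gaussChar`, which lowers the degree of the polynomial `P`. -/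
lemma integral_mul_coord_gaussChar {d : ℕ} {s : ℝ} (hs : 0 < s) (x : Space d) (j : Fin d)
    {P P' : Space d → ℂ} (n : ℕ) (hP : Differentiable ℝ P) (hn : ∀ ξ, ‖P ξ‖ ≤ ‖ξ‖ ^ n)
    (hP' : ∀ ξ, fderiv ℝ P ξ (EuclideanSpace.single j 1) = P' ξ)
    (hi : Integrable fun ξ => P' ξ * gaussChar s x ξ) :
    ∫ ξ, P ξ * (ξ j : ℂ) * gaussChar s x ξ =
      (2 * s : ℂ)⁻¹ * (Complex.I * x j * (∫ ξ, P ξ * gaussChar s x ξ) +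
        ∫ ξ, P' ξ * gaussChar s x ξ) := by
  have hg (ξ : Space d) : fderiv ℝ (gaussChar s x) ξ (EuclideanSpace.single j 1) =
      (-2 * s * (ξ j : ℂ) + Complex.I * (x j : ℂ)) * gaussChar s x ξ := by
    obtain ⟨L, hL, h⟩ := hasFDerivAt_gaussChar s x ξ
    rw [hL.fderiv, h]
  have hgd : Differentiable ℝ (gaussChar s x) := fun ξ => by
    obtain ⟨L, hL, -⟩ := hasFDerivAt_gaussChar s x ξ
    exact hL.differentiableAt
  have i0 := integrable_mul_gaussChar hP.continuous n hn hs x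
  have i1 : Integrable fun ξ => P ξ * (ξ j : ℂ) * gaussChar s x ξ := by
    refine integrable_mul_gaussChar (P := fun ξ => P ξ * (ξ j : ℂ))
      (hP.continuous.mul (by fun_prop)) (n + 1) (fun ξ => ?_) hs x
    rw [norm_mul, pow_succ]
    gcongr
    exacts [hn ξ, norm_coord_le ξ j]
  have i2 : Integrable fun ξ => P ξ * ((-2 * s * (ξ j : ℂ) + Complex.I * (x j : ℂ)) *
      gaussChar s x ξ) := by
    refine ((i1.const_mul (-2 * s : ℂ)).add (i0.const_mul (Complex.I * x j))).congr
      (Filter.Eventually.of_forall fun ξ => ?_)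
    simp only [Pi.add_apply]; ring
  have key := integral_mul_fderiv_eq_neg_fderiv_mul_of_integrable (μ := volume) (f := P)
    (g := gaussChar s x) (v := EuclideanSpace.single j (1 : ℝ)) (by simpa only [hP'] using hi)
    (by simpa only [hg] using i2) i0 (fun ξ _ => hP ξ) (fun ξ _ => hgd ξ)
  simp only [hg, hP'] at key
  have e : (fun ξ => P ξ * ((-2 * s * (ξ j : ℂ) + Complex.I * (x j : ℂ)) * gaussChar s x ξ)) =
      fun ξ => (-2 * s : ℂ) * (P ξ * (ξ j : ℂ) * gaussChar s x ξ) +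
        (Complex.I * x j) * (P ξ * gaussChar s x ξ) := by
    funext ξ; ring
  rw [e, integral_add (i1.const_mul _) (i0.const_mul _), integral_const_mul,
    integral_const_mul] at key
  have hs' : (s : ℂ) ≠ 0 := by exact_mod_cast hs.ne'
  field_simp
  linear_combination (-1 : ℂ) * key

lemma integral_gaussChar {d : ℕ} {s : ℝ} (hs : 0 < s) (x : Space d) :
    ((2 * Real.pi : ℂ) ^ d)⁻¹ * ∫ ξ, gaussChar s x ξ =
      (((4 * Real.pi * s) ^ (-(d : ℝ) / 2) * Real.exp (-‖x‖ ^ 2 / (4 * s)) : ℝ) : ℂ) := by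
  have h := GaussianFourier.integral_cexp_neg_mul_sq_norm_add (V := Space d) (b := (s : ℂ))
    (by simpa using hs) Complex.I x
  have e1 : (∫ ξ, gaussChar s x ξ) =
      (Real.pi / (s : ℂ)) ^ ((d : ℂ) / 2) * Complex.exp (-(‖x‖ : ℂ) ^ 2 / (4 * s)) := by
    unfold gaussChar
    rw [h]
    simp
  have e2 : (Real.pi / (s : ℂ)) ^ ((d : ℂ) / 2) = (((Real.pi / s) ^ ((d : ℝ) / 2) : ℝ) : ℂ) := by
    rw [Complex.ofReal_cpow (by positivity)]
    push_cast; rfl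
  have e3 : ((2 * Real.pi) ^ d)⁻¹ * (Real.pi / s) ^ ((d : ℝ) / 2) =
      (4 * Real.pi * s) ^ (-(d : ℝ) / 2) := by
    have hp := Real.pi_pos
    have : (2 * Real.pi) ^ d = ((2 * Real.pi) ^ 2) ^ ((d : ℝ) / 2) := by
      rw [← Real.rpow_natCast (2 * Real.pi) 2, ← Real.rpow_mul (by positivity),
        ← Real.rpow_natCast]
      congr 1; push_cast; ring
    rw [this, ← Real.inv_rpow (by positivity), ← Real.mul_rpow (by positivity) (by positivity),
      neg_div, Real.rpow_neg (by positivity), ← Real.inv_rpow (by positivity)]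
    congr 1
    field_simp
    ring
  rw [e1, e2, ← e3]
  push_cast
  ring

/-- The heat kernel `(4πs)^{-d/2} e^{-|x|²/(4s)}`. -/
noncomputable def heatKernel {d : ℕ} (s : ℝ) (x : Space d) : ℝ :=
  (4 * Real.pi * s) ^ (-(d : ℝ) / 2) * Real.exp (-‖x‖ ^ 2 / (4 * s))

/-- `∂_h` of the heat kernel. -/
noncomputable def heatKernelD1 {d : ℕ} (h : Fin d) (s : ℝ) (x : Space d) : ℝ :=
  -(x h / (2 * s)) * heatKernel s x

/-- `∂_j ∂_h ∂_k` of the heat kernel. -/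
noncomputable def heatKernelD3 {d : ℕ} (j h k : Fin d) (s : ℝ) (x : Space d) : ℝ :=
  (-(x j * x h * x k) / (8 * s ^ 3) +
    (x j * kron h k + x h * kron j k + x k * kron j h) / (4 * s ^ 2)) * heatKernel s x

lemma fderiv_coord {d : ℕ} (h j : Fin d) (ξ : Space d) :
    fderiv ℝ (fun ξ : Space d => ((ξ h : ℝ) : ℂ)) ξ (EuclideanSpace.single j 1) = kron j h := by
  have : HasFDerivAt (fun ξ : Space d => ((ξ h : ℝ) : ℂ))
      (Complex.ofRealCLM.comp (EuclideanSpace.proj h : Space d →L[ℝ] ℝ)) ξ :=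
    Complex.ofRealCLM.hasFDerivAt.comp ξ (EuclideanSpace.proj h : Space d →L[ℝ] ℝ).hasFDerivAt
  rw [this.fderiv]
  simp [kron, eq_comm]

lemma differentiable_coord {d : ℕ} (h : Fin d) :
    Differentiable ℝ (fun ξ : Space d => ((ξ h : ℝ) : ℂ)) := by
  fun_prop

lemma integral_coord_gaussChar {d : ℕ} {s : ℝ} (hs : 0 < s) (x : Space d) (h : Fin d) :
    ∫ ξ, (ξ h : ℂ) * gaussChar s x ξ =
      (2 * s : ℂ)⁻¹ * (Complex.I * x h * ∫ ξ, gaussChar s x ξ) := by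
  have := integral_mul_coord_gaussChar hs x h (P := fun _ => 1) (P' := fun _ => 0) 0
    (by fun_prop) (by simp) (by simp) (by simp)
  simpa using this

lemma integral_coord_coord_gaussChar {d : ℕ} {s : ℝ} (hs : 0 < s) (x : Space d) (h k : Fin d) :
    ∫ ξ, (ξ h : ℂ) * (ξ k : ℂ) * gaussChar s x ξ =
      (2 * s : ℂ)⁻¹ * (Complex.I * x k * (∫ ξ, (ξ h : ℂ) * gaussChar s x ξ) +
        kron k h * ∫ ξ, gaussChar s x ξ) := by
  have i0 : Integrable fun ξ : Space d => gaussChar s x ξ := by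
    simpa using integrable_mul_gaussChar (P := fun _ => 1) (by fun_prop) 0 (by simp) hs x
  have := integral_mul_coord_gaussChar hs x k (P := fun ξ => (ξ h : ℂ))
    (P' := fun _ => (kron k h : ℂ)) 1 (differentiable_coord h)
    (fun ξ => by simpa using norm_coord_le ξ h) (fderiv_coord h k) (i0.const_mul _)
  rw [this, integral_const_mul]

lemma integral_coord_coord_coord_gaussChar {d : ℕ} {s : ℝ} (hs : 0 < s) (x : Space d)
    (j h k : Fin d) :
    ∫ ξ, (ξ h : ℂ) * (ξ k : ℂ) * (ξ j : ℂ) * gaussChar s x ξ =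
      (2 * s : ℂ)⁻¹ * (Complex.I * x j * (∫ ξ, (ξ h : ℂ) * (ξ k : ℂ) * gaussChar s x ξ) +
        (kron j h * (∫ ξ, (ξ k : ℂ) * gaussChar s x ξ) +
          kron j k * ∫ ξ, (ξ h : ℂ) * gaussChar s x ξ)) := by
  have i1 (h : Fin d) : Integrable fun ξ : Space d => (ξ h : ℂ) * gaussChar s x ξ :=
    integrable_mul_gaussChar (differentiable_coord h).continuous 1
      (fun ξ => by simpa using norm_coord_le ξ h) hs x
  have e : (fun ξ : Space d => ((kron j h : ℂ) * (ξ k : ℂ) + kron j k * (ξ h : ℂ)) *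
      gaussChar s x ξ) = fun ξ => (kron j h : ℂ) * ((ξ k : ℂ) * gaussChar s x ξ) +
        kron j k * ((ξ h : ℂ) * gaussChar s x ξ) := by
    funext ξ; ring
  have := integral_mul_coord_gaussChar hs x j (P := fun ξ => (ξ h : ℂ) * (ξ k : ℂ))
    (P' := fun ξ => (kron j h : ℂ) * (ξ k : ℂ) + kron j k * (ξ h : ℂ)) 2
    ((differentiable_coord h).mul (differentiable_coord k))
    (fun ξ => by
      rw [norm_mul, sq]; gcongr <;> exact norm_coord_le ξ _)
    (fun ξ => by
      rw [fderiv_fun_mul (differentiable_coord h ξ) (differentiable_coord k ξ)]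
      simp only [add_apply, smul_apply, fderiv_coord,
        smul_eq_mul]
      ring)
    (by rw [e]; exact ((i1 k).const_mul _).add ((i1 h).const_mul _))
  rw [this, e, integral_add ((i1 k).const_mul _) ((i1 h).const_mul _), integral_const_mul,
    integral_const_mul]

lemma fourier_heatKernelD1 {d : ℕ} {s : ℝ} (hs : 0 < s) (x : Space d) (h : Fin d) :
    ((2 * Real.pi : ℂ) ^ d)⁻¹ * ∫ ξ, Complex.I * gaussChar s x ξ * (ξ h : ℂ) =
      (heatKernelD1 h s x : ℂ) := by
  have e : (fun ξ : Space d => Complex.I * gaussChar s x ξ * (ξ h : ℂ)) =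
      fun ξ => Complex.I * ((ξ h : ℂ) * gaussChar s x ξ) := by funext ξ; ring
  have h0 := integral_gaussChar hs x
  rw [e, integral_const_mul, integral_coord_gaussChar hs]
  have hs' : (s : ℂ) ≠ 0 := by exact_mod_cast hs.ne'
  have hI := Complex.I_sq
  rw [heatKernelD1, heatKernel, Complex.ofReal_mul, ← h0]
  push_cast
  field_simp
  linear_combination (x h : ℂ) * (∫ ξ, gaussChar s x ξ) * hI

lemma fourier_heatKernelD3 {d : ℕ} {s : ℝ} (hs : 0 < s) (x : Space d) (j h k : Fin d) :
    ((2 * Real.pi : ℂ) ^ d)⁻¹ *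
        ∫ ξ, Complex.I * gaussChar s x ξ * (-(ξ j * ξ h * ξ k : ℝ) : ℂ) =
      (heatKernelD3 j h k s x : ℂ) := by
  have e : (fun ξ : Space d => Complex.I * gaussChar s x ξ * (-(ξ j * ξ h * ξ k : ℝ) : ℂ)) =
      fun ξ => (-Complex.I) * ((ξ h : ℂ) * (ξ k : ℂ) * (ξ j : ℂ) * gaussChar s x ξ) := by
    funext ξ; push_cast; ring
  have h0 := integral_gaussChar hs x
  have hk : kron k h = kron h k := by simp [kron, eq_comm]
  rw [e, integral_const_mul, integral_coord_coord_coord_gaussChar hs,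
    integral_coord_coord_gaussChar hs, integral_coord_gaussChar hs, integral_coord_gaussChar hs]
  have hs' : (s : ℂ) ≠ 0 := by exact_mod_cast hs.ne'
  have hI := Complex.I_sq
  have hI4 : Complex.I ^ 4 = 1 := Complex.I_pow_four
  rw [heatKernelD3, heatKernel, Complex.ofReal_mul, ← h0, hk]
  push_cast
  field_simp
  ring_nf
  simp only [hI, hI4]
  ring

/-! ### The kernel as a time integral of heat kernels -/

lemma gaussChar_eq_ofReal_mul {d : ℕ} (s : ℝ) (x ξ : Space d) :
    gaussChar s x ξ =
      (Real.exp (-‖ξ‖ ^ 2 * s) : ℂ) * Complex.exp (Complex.I * (inner ℝ x ξ : ℝ)) := by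
  rw [gaussChar, Complex.exp_add]
  push_cast
  congr 2
  ring

/-- The multiplier `e^{-t|ξ|²}/|ξ|²` is the time integral of `e^{-s|ξ|²}` over `s > t`. -/
lemma integral_Ioi_gaussChar {d : ℕ} (t : ℝ) (x ξ : Space d) (j h k : Fin d) :
    ∫ s in Set.Ioi t, Complex.I * gaussChar s x ξ * (-(ξ j * ξ h * ξ k : ℝ) : ℂ) =
      Complex.I * gaussChar t x ξ * (-(ξ j * ξ h * ξ k / ‖ξ‖ ^ 2 : ℝ) : ℂ) := by
  -- At `ξ = 0` both sides vanish: the cubic is `0`, and so is its quotient by `0`.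
  by_cases h0 : ξ = 0
  · simp [h0]
  have hn : 0 < ‖ξ‖ ^ 2 := by positivity
  have e : (fun s : ℝ => Complex.I * gaussChar s x ξ * (-(ξ j * ξ h * ξ k : ℝ) : ℂ)) =
      fun s => (Complex.I * Complex.exp (Complex.I * (inner ℝ x ξ : ℝ)) *
        (-(ξ j * ξ h * ξ k : ℝ) : ℂ)) * (Real.exp (-‖ξ‖ ^ 2 * s) : ℂ) := by
    funext s; rw [gaussChar_eq_ofReal_mul]; ring
  rw [e, integral_const_mul, integral_complex_ofReal, integral_exp_mul_Ioi (by linarith),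
    gaussChar_eq_ofReal_mul]
  push_cast
  field_simp

lemma abs_coord_mul_three_le {d : ℕ} (ξ : Space d) (j h k : Fin d) :
    |ξ j * ξ h * ξ k| ≤ ‖ξ‖ ^ 3 := by
  rw [abs_mul, abs_mul, show ‖ξ‖ ^ 3 = ‖ξ‖ * ‖ξ‖ * ‖ξ‖ by ring]
  gcongr <;> exact abs_coord_le_norm ξ _

/-- Absolute convergence of the double integral that represents the cubic part of the symbol. -/
lemma integrable_prod_gaussChar {d : ℕ} {t : ℝ} (ht : 0 < t) (x : Space d) (j h k : Fin d) :
    Integrable (Function.uncurry fun (ξ : Space d) (s : ℝ) =>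
      Complex.I * gaussChar s x ξ * (-(ξ j * ξ h * ξ k : ℝ) : ℂ))
      (volume.prod (volume.restrict (Set.Ioi t))) := by
  have hc : Continuous (Function.uncurry fun (ξ : Space d) (s : ℝ) =>
      Complex.I * gaussChar s x ξ * (-(ξ j * ξ h * ξ k : ℝ) : ℂ)) := by
    unfold gaussChar Function.uncurry; fun_prop
  have hnorm (ξ : Space d) (s : ℝ) :
      ‖Complex.I * gaussChar s x ξ * (-(ξ j * ξ h * ξ k : ℝ) : ℂ)‖ =
        |ξ j * ξ h * ξ k| * Real.exp (-‖ξ‖ ^ 2 * s) := by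
    rw [norm_mul, norm_mul, norm_gaussChar, norm_neg, Complex.norm_real, Complex.norm_I, one_mul,
      Real.norm_eq_abs, mul_comm, show -s * ‖ξ‖ ^ 2 = -‖ξ‖ ^ 2 * s by ring]
  rw [integrable_prod_iff hc.aestronglyMeasurable]
  constructor
  · refine Filter.Eventually.of_forall fun ξ => ?_
    by_cases h0 : ξ = 0
    · simp [h0, Function.uncurry]
    have hn : 0 < ‖ξ‖ ^ 2 := by positivity
    refine ((integrableOn_exp_mul_Ioi (a := -‖ξ‖ ^ 2) (by linarith) t).const_mul
      |ξ j * ξ h * ξ k|).mono'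
      (hc.comp (Continuous.prodMk_right ξ)).aestronglyMeasurable
      (Filter.Eventually.of_forall fun s => ?_)
    simp only [Function.uncurry_apply_pair, hnorm, le_refl]
  · refine (integrable_pow_mul_exp_neg_mul_norm_sq (d := d) 1 ht).mono'
      (hc.norm.aestronglyMeasurable.integral_prod_right')
      (Filter.Eventually.of_forall fun ξ => ?_)
    simp only [Function.uncurry_apply_pair, hnorm]
    rw [integral_const_mul]
    by_cases h0 : ξ = 0
    · simp [h0]
    have hn : 0 < ‖ξ‖ := by positivity
    rw [integral_exp_mul_Ioi (by nlinarith), Real.norm_of_nonneg (by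
      rw [neg_div_neg_eq]; positivity), neg_div_neg_eq, show -‖ξ‖ ^ 2 * t = -t * ‖ξ‖ ^ 2 by ring,
      ← mul_div_assoc, div_le_iff₀ (by positivity)]
    calc _ ≤ ‖ξ‖ ^ 3 * Real.exp (-t * ‖ξ‖ ^ 2) := by
          gcongr; exact abs_coord_mul_three_le ξ j h k
      _ = _ := by ring

/-- The Oseen-type kernel is a first derivative of the heat kernel plus the time integral of a
third derivative, because `|ξ|⁻² e^{-t|ξ|²} = ∫_t^∞ e^{-s|ξ|²} ds`. -/
lemma kernelF_eq {d : ℕ} (j h k : Fin d) (x : Space d) {t : ℝ} (ht : 0 < t) :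
    kernelF j h k x t =
      1 / 2 * (kron j k * heatKernelD1 h t x + kron j h * heatKernelD1 k t x) +
        ∫ s in Set.Ioi t, heatKernelD3 j h k s x := by
  have i1 (h : Fin d) : Integrable fun ξ : Space d => Complex.I * gaussChar t x ξ * (ξ h : ℂ) := by
    refine ((integrable_mul_gaussChar (differentiable_coord h).continuous 1
      (fun ξ => by simpa using norm_coord_le ξ h) ht x).const_mul Complex.I).congr
      (Filter.Eventually.of_forall fun ξ => by ring)
  have hprod := integrable_prod_gaussChar ht x j h k
  have i3 : Integrable fun ξ : Space d =>
      Complex.I * gaussChar t x ξ * (-(ξ j * ξ h * ξ k / ‖ξ‖ ^ 2 : ℝ) : ℂ) := by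
    refine hprod.integral_prod_left.congr (Filter.Eventually.of_forall fun ξ => ?_)
    exact integral_Ioi_gaussChar t x ξ j h k
  have e : (fun ξ : Space d => Complex.I * Complex.exp (-(t : ℂ) * (‖ξ‖ : ℂ) ^ 2 +
      Complex.I * (inner ℝ x ξ : ℝ)) * (lerayDivSymbol j h k ξ : ℂ)) =
      fun ξ => ((kron j k / 2 : ℂ) * (Complex.I * gaussChar t x ξ * (ξ h : ℂ)) +
        (kron j h / 2 : ℂ) * (Complex.I * gaussChar t x ξ * (ξ k : ℂ))) +
        Complex.I * gaussChar t x ξ * (-(ξ j * ξ h * ξ k / ‖ξ‖ ^ 2 : ℝ) : ℂ) := by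
    funext ξ
    rw [lerayDivSymbol, gaussChar]
    push_cast
    ring
  have e3 : ((2 * Real.pi : ℂ) ^ d)⁻¹ * (∫ ξ : Space d,
      Complex.I * gaussChar t x ξ * (-(ξ j * ξ h * ξ k / ‖ξ‖ ^ 2 : ℝ) : ℂ)) =
      ((∫ s in Set.Ioi t, heatKernelD3 j h k s x : ℝ) : ℂ) := by
    rw [← integral_complex_ofReal]
    simp only [← integral_Ioi_gaussChar t x _ j h k]
    rw [integral_integral_swap hprod, ← integral_const_mul]
    refine setIntegral_congr_fun measurableSet_Ioi fun s hs => ?_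
    exact fourier_heatKernelD3 (ht.trans hs) x j h k
  have i2 : Integrable fun ξ : Space d =>
      (kron j k / 2 : ℂ) * (Complex.I * gaussChar t x ξ * (ξ h : ℂ)) +
        (kron j h / 2 : ℂ) * (Complex.I * gaussChar t x ξ * (ξ k : ℂ)) :=
    ((i1 h).const_mul _).add ((i1 k).const_mul _)
  rw [kernelF, e, integral_add i2 i3,
    integral_add ((i1 h).const_mul _) ((i1 k).const_mul _), integral_const_mul,
    integral_const_mul, mul_add, mul_add, mul_left_comm, fourier_heatKernelD1 ht,
    mul_left_comm, fourier_heatKernelD1 ht, e3, ← Complex.ofReal_re (_ + _)]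
  congr 1
  push_cast
  ring

lemma stronglyMeasurable_kernelF {d : ℕ} (j h k : Fin d) :
    StronglyMeasurable fun p : Space d × ℝ => kernelF j h k p.1 p.2 := by
  unfold kernelF lerayDivSymbol
  refine (Complex.measurable_re.comp (Measurable.const_mul ?_ _)).stronglyMeasurable
  refine (StronglyMeasurable.integral_prod_right (f := fun (p : Space d × ℝ) (ξ : Space d) =>
    Complex.I * Complex.exp (-(p.2 : ℂ) * (‖ξ‖ : ℂ) ^ 2 + Complex.I * (inner ℝ p.1 ξ : ℝ)) *
      ((1 / 2 * (ξ h * kron j k + ξ k * kron j h) - ξ j * ξ h * ξ k / ‖ξ‖ ^ 2 : ℝ) : ℂ))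
      ?_).measurable
  refine Measurable.stronglyMeasurable ?_
  unfold Function.uncurry
  fun_prop

/-! ### Gaussian profiles and bounds for the derivatives of the heat kernel -/

lemma abs_exp_neg_sub_exp_neg_le {a b m : ℝ} (ha : m ≤ a) (hb : m ≤ b) :
    |Real.exp (-a) - Real.exp (-b)| ≤ |a - b| * Real.exp (-m) := by
  wlog hab : a ≤ b generalizing a b
  · rw [abs_sub_comm, abs_sub_comm a b]
    exact this hb ha (le_of_not_ge hab)
  have h1 : Real.exp (-b) ≤ Real.exp (-a) := Real.exp_le_exp.2 (by linarith)
  rw [abs_of_nonneg (by linarith), abs_sub_comm, abs_of_nonneg (by linarith)]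
  have h2 : Real.exp (-b) = Real.exp (-a) * Real.exp (-(b - a)) := by
    rw [← Real.exp_add]; congr 1; ring
  have h3 := Real.add_one_le_exp (-(b - a))
  have h4 : Real.exp (-a) ≤ Real.exp (-m) := Real.exp_le_exp.2 (by linarith)
  have h5 := Real.exp_pos (-a)
  rw [h2]
  nlinarith

/-- A polynomial of controlled growth times `e^{-|z|²/4}` decays like a Gaussian, and so do its
increments over distances at most `|z|/2`. -/
lemma exists_profile_bound : ∃ A : ℝ, 0 < A ∧ ∀ (d : ℕ) (p : Space d → ℝ),
    (∀ z, |p z| ≤ (1 + ‖z‖) ^ 3) →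
    (∀ z w, ‖w‖ ≤ ‖z‖ / 2 → |p (z - w) - p z| ≤ 2 * ‖w‖ * (1 + ‖z‖) ^ 2) →
    (∀ z, |p z * Real.exp (-‖z‖ ^ 2 / 4)| ≤ A * Real.exp (-(1 / 32) * ‖z‖ ^ 2)) ∧
    ∀ z w, ‖w‖ ≤ ‖z‖ / 2 → |p (z - w) * Real.exp (-‖z - w‖ ^ 2 / 4) -
      p z * Real.exp (-‖z‖ ^ 2 / 4)| ≤ A * ‖w‖ * Real.exp (-(1 / 32) * ‖z‖ ^ 2) := by
  obtain ⟨C, hC, h⟩ := exists_pow_le_exp_sq 4 (δ := 1 / 64) (by norm_num)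
  have key (n : ℝ) (hn : 0 ≤ n) : (1 + n) ^ 4 * Real.exp (-(n ^ 2 / 16)) ≤
      C * Real.exp (1 / 32) * Real.exp (-(1 / 32) * n ^ 2) := by
    calc _ ≤ C * Real.exp (1 / 64 * (1 + n) ^ 2) * Real.exp (-(n ^ 2 / 16)) := by
          gcongr; exact h _ (by linarith)
      _ = C * Real.exp (1 / 64 * (1 + n) ^ 2 + -(n ^ 2 / 16)) := by
          rw [Real.exp_add]; ring
      _ ≤ C * Real.exp (1 / 32 + -(1 / 32) * n ^ 2) := by
          have : 1 / 64 * (1 + n) ^ 2 + -(n ^ 2 / 16) ≤ 1 / 32 + -(1 / 32) * n ^ 2 := by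
            nlinarith [sq_nonneg (n - 1)]
          gcongr
      _ = _ := by rw [Real.exp_add]; ring
  refine ⟨3 * (C * Real.exp (1 / 32)), by positivity,
    fun d p hp hd => ⟨fun z => ?_, fun z w hw => ?_⟩⟩
  · have hn := norm_nonneg z
    have k := key _ hn
    rw [abs_mul, Real.abs_exp]
    calc |p z| * Real.exp (-‖z‖ ^ 2 / 4) ≤ (1 + ‖z‖) ^ 4 * Real.exp (-(‖z‖ ^ 2 / 16)) := by
          gcongr
          · exact (hp z).trans (pow_le_pow_right₀ (by linarith) (by norm_num))
          · nlinarith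
      _ ≤ _ := k
      _ ≤ _ := by
          have : 0 < C * Real.exp (1 / 32) * Real.exp (-(1 / 32) * ‖z‖ ^ 2) := by positivity
          nlinarith
  · have hn := norm_nonneg z
    have hω := norm_nonneg w
    have k := key _ hn
    have hlow : ‖z‖ / 2 ≤ ‖z - w‖ := by
      have := norm_sub_norm_le z w; linarith
    have hup : |‖z - w‖ - ‖z‖| ≤ ‖w‖ := by
      simpa using abs_norm_sub_norm_le (z - w) z
    have hA : ‖z‖ ^ 2 / 16 ≤ ‖z - w‖ ^ 2 / 4 := by nlinarith
    have hB : ‖z‖ ^ 2 / 16 ≤ ‖z‖ ^ 2 / 4 := by nlinarith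
    have e1 := abs_exp_neg_sub_exp_neg_le hA hB
    have e2 : |‖z - w‖ ^ 2 / 4 - ‖z‖ ^ 2 / 4| ≤ ‖z‖ * ‖w‖ := by
      have : ‖z - w‖ ^ 2 / 4 - ‖z‖ ^ 2 / 4 = (‖z - w‖ - ‖z‖) * ((‖z - w‖ + ‖z‖) / 4) := by ring
      rw [this, abs_mul, mul_comm, abs_of_nonneg (by positivity)]
      have : ‖z - w‖ ≤ ‖z‖ + ‖w‖ := norm_sub_le z w
      gcongr
      linarith
    set m := Real.exp (-(‖z‖ ^ 2 / 16)) with hm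
    have e3 : Real.exp (-(‖z - w‖ ^ 2 / 4)) ≤ m := Real.exp_le_exp.2 (by linarith)
    have hm0 : 0 < m := Real.exp_pos _
    calc |p (z - w) * Real.exp (-‖z - w‖ ^ 2 / 4) - p z * Real.exp (-‖z‖ ^ 2 / 4)|
        = |(p (z - w) - p z) * Real.exp (-(‖z - w‖ ^ 2 / 4)) +
            p z * (Real.exp (-(‖z - w‖ ^ 2 / 4)) - Real.exp (-(‖z‖ ^ 2 / 4)))| := by
          simp only [neg_div]; congr 1; ring
      _ ≤ |p (z - w) - p z| * Real.exp (-(‖z - w‖ ^ 2 / 4)) +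
            |p z| * |Real.exp (-(‖z - w‖ ^ 2 / 4)) - Real.exp (-(‖z‖ ^ 2 / 4))| := by
          refine (abs_add_le _ _).trans_eq ?_
          rw [abs_mul, abs_mul, Real.abs_exp]
      _ ≤ (2 * ‖w‖ * (1 + ‖z‖) ^ 2) * m + (1 + ‖z‖) ^ 3 * ((‖z‖ * ‖w‖) * m) := by
          gcongr
          · exact hd z w hw
          · exact hp z
          · exact e1.trans (by gcongr)
      _ = (2 * (1 + ‖z‖) ^ 2 + (1 + ‖z‖) ^ 3 * ‖z‖) * (‖w‖ * m) := by ring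
      _ ≤ (3 * (1 + ‖z‖) ^ 4) * (‖w‖ * m) := by
          gcongr
          have h1 : (1 + ‖z‖) ^ 2 ≤ (1 + ‖z‖) ^ 4 := pow_le_pow_right₀ (by linarith) (by norm_num)
          have h2 : (1 + ‖z‖) ^ 3 * ‖z‖ ≤ (1 + ‖z‖) ^ 4 := by
            rw [pow_succ _ 3]; gcongr; linarith
          linarith
      _ = 3 * ‖w‖ * ((1 + ‖z‖) ^ 4 * m) := by ring
      _ ≤ 3 * ‖w‖ * (C * Real.exp (1 / 32) * Real.exp (-(1 / 32) * ‖z‖ ^ 2)) := by gcongr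
      _ = _ := by ring

lemma kron_nonneg {d : ℕ} (i j : Fin d) : 0 ≤ kron i j := by
  unfold kron; split_ifs <;> norm_num

lemma kron_le_one {d : ℕ} (i j : Fin d) : kron i j ≤ 1 := by
  unfold kron; split_ifs <;> norm_num

lemma abs_mul_kron_le {d : ℕ} (a : ℝ) (i j : Fin d) : |a * kron i j| ≤ |a| := by
  rw [abs_mul, abs_of_nonneg (kron_nonneg i j)]
  exact mul_le_of_le_one_right (abs_nonneg _) (kron_le_one i j)

/-- The polynomial factor of `∂_h e^{-|z|²/4}`. -/
noncomputable def profile1 {d : ℕ} (h : Fin d) (z : Space d) : ℝ := -(z h / 2)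

/-- The polynomial factor of `∂_j ∂_h ∂_k e^{-|z|²/4}`. -/
noncomputable def profile3 {d : ℕ} (j h k : Fin d) (z : Space d) : ℝ :=
  -(z j * z h * z k) / 8 + (z j * kron h k + z h * kron j k + z k * kron j h) / 4

lemma abs_profile1_le {d : ℕ} (h : Fin d) (z : Space d) : |profile1 h z| ≤ (1 + ‖z‖) ^ 3 := by
  have h1 := abs_coord_le_norm z h
  have hn := norm_nonneg z
  rw [profile1, abs_neg, abs_div, abs_two]
  have : 1 + ‖z‖ ≤ (1 + ‖z‖) ^ 3 := le_self_pow₀ (by linarith) (by norm_num)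
  linarith

lemma abs_profile1_sub_le {d : ℕ} (h : Fin d) (z w : Space d) :
    |profile1 h (z - w) - profile1 h z| ≤ 2 * ‖w‖ * (1 + ‖z‖) ^ 2 := by
  have h1 := abs_coord_le_norm w h
  have hn := norm_nonneg z
  have hw := norm_nonneg w
  have : profile1 h (z - w) - profile1 h z = w h / 2 := by
    simp only [profile1, PiLp.sub_apply]; ring
  rw [this, abs_div, abs_two]
  have : 1 ≤ (1 + ‖z‖) ^ 2 := one_le_pow₀ (by linarith)
  nlinarith

lemma abs_profile3_le {d : ℕ} (j h k : Fin d) (z : Space d) :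
    |profile3 j h k z| ≤ (1 + ‖z‖) ^ 3 := by
  have hn := norm_nonneg z
  have h1 := abs_coord_mul_three_le z j h k
  have h2 := (abs_mul_kron_le (z j) h k).trans (abs_coord_le_norm z j)
  have h3 := (abs_mul_kron_le (z h) j k).trans (abs_coord_le_norm z h)
  have h4 := (abs_mul_kron_le (z k) j h).trans (abs_coord_le_norm z k)
  rw [abs_le] at *
  unfold profile3
  constructor <;> nlinarith [pow_nonneg hn 3, pow_nonneg hn 2]

lemma abs_profile3_sub_le {d : ℕ} (j h k : Fin d) (z w : Space d) (hw : ‖w‖ ≤ ‖z‖ / 2) :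
    |profile3 j h k (z - w) - profile3 j h k z| ≤ 2 * ‖w‖ * (1 + ‖z‖) ^ 2 := by
  have hn := norm_nonneg z
  have hω := norm_nonneg w
  have hz (i : Fin d) : |z i| ≤ 2 * ‖z‖ := (abs_coord_le_norm z i).trans (by linarith)
  have hzw (i : Fin d) : |z i - w i| ≤ 2 * ‖z‖ :=
    (abs_coord_le_norm (z - w) i).trans ((norm_sub_le z w).trans (by linarith))
  have hwi (i : Fin d) := abs_coord_le_norm w i
  have c1 : |w j * (z h - w h) * (z k - w k)| ≤ ‖w‖ * (2 * ‖z‖) * (2 * ‖z‖) := by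
    rw [abs_mul, abs_mul]; gcongr <;> first | exact hwi _ | exact hzw _
  have c2 : |z j * w h * (z k - w k)| ≤ (2 * ‖z‖) * ‖w‖ * (2 * ‖z‖) := by
    rw [abs_mul, abs_mul]; gcongr <;> first | exact hwi _ | exact hzw _ | exact hz _
  have c3 : |z j * z h * w k| ≤ (2 * ‖z‖) * (2 * ‖z‖) * ‖w‖ := by
    rw [abs_mul, abs_mul]; gcongr <;> first | exact hwi _ | exact hz _
  have h2 := (abs_mul_kron_le (w j) h k).trans (hwi j)
  have h3 := (abs_mul_kron_le (w h) j k).trans (hwi h)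
  have h4 := (abs_mul_kron_le (w k) j h).trans (hwi k)
  have e : profile3 j h k (z - w) - profile3 j h k z =
      (w j * (z h - w h) * (z k - w k) + z j * w h * (z k - w k) + z j * z h * w k) / 8 -
        (w j * kron h k + w h * kron j k + w k * kron j h) / 4 := by
    simp only [profile3, PiLp.sub_apply]; ring
  rw [e]
  have : (3 * (4 * ‖w‖ * ‖z‖ ^ 2)) / 8 + 3 * ‖w‖ / 4 ≤ 2 * ‖w‖ * (1 + ‖z‖) ^ 2 := by
    nlinarith [mul_nonneg hω hn, mul_nonneg hω (sq_nonneg ‖z‖)]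
  rw [abs_le] at *
  constructor <;> nlinarith

lemma heatKernelD1_eq_profile {d : ℕ} (h : Fin d) {s : ℝ} (hs : 0 < s) (x : Space d) :
    heatKernelD1 h s x = (4 * Real.pi) ^ (-(d : ℝ) / 2) * s ^ (-((d : ℝ) + 1) / 2) *
      (profile1 h ((Real.sqrt s)⁻¹ • x) * Real.exp (-‖(Real.sqrt s)⁻¹ • x‖ ^ 2 / 4)) := by
  have hr : 0 < Real.sqrt s := Real.sqrt_pos.2 hs
  have e1 : s ^ (-((d : ℝ) + 1) / 2) = s ^ (-(d : ℝ) / 2) * (Real.sqrt s)⁻¹ := by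
    rw [Real.sqrt_eq_rpow, ← Real.rpow_neg hs.le, ← Real.rpow_add hs]; congr 1; ring
  have e2 : -‖(Real.sqrt s)⁻¹ • x‖ ^ 2 / 4 = -‖x‖ ^ 2 / (4 * s) := by
    rw [norm_smul, Real.norm_of_nonneg (by positivity), mul_pow, inv_pow, Real.sq_sqrt hs.le]
    field_simp
  rw [e1, e2, heatKernelD1, heatKernel, Real.mul_rpow (by positivity) hs.le, profile1]
  have e3 : ((Real.sqrt s)⁻¹ • x) h = (Real.sqrt s)⁻¹ * x h := by simp
  have e4 : s⁻¹ = (Real.sqrt s)⁻¹ * (Real.sqrt s)⁻¹ := by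
    rw [← mul_inv, Real.mul_self_sqrt hs.le]
  rw [e3, show x h / (2 * s) = x h / 2 * s⁻¹ by field_simp, e4]
  ring

lemma heatKernelD3_eq_profile {d : ℕ} (j h k : Fin d) {s : ℝ} (hs : 0 < s) (x : Space d) :
    heatKernelD3 j h k s x = (4 * Real.pi) ^ (-(d : ℝ) / 2) * s ^ (-((d : ℝ) + 3) / 2) *
      (profile3 j h k ((Real.sqrt s)⁻¹ • x) * Real.exp (-‖(Real.sqrt s)⁻¹ • x‖ ^ 2 / 4)) := by
  have hr : 0 < Real.sqrt s := Real.sqrt_pos.2 hs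
  have hss := Real.sq_sqrt hs.le
  have e1 : s ^ (-((d : ℝ) + 3) / 2) = s ^ (-(d : ℝ) / 2) * ((Real.sqrt s) ^ 3)⁻¹ := by
    rw [Real.sqrt_eq_rpow, ← Real.rpow_natCast, ← Real.rpow_mul hs.le, ← Real.rpow_neg hs.le,
      ← Real.rpow_add hs]
    congr 1; push_cast; ring
  have e2 : -‖(Real.sqrt s)⁻¹ • x‖ ^ 2 / 4 = -‖x‖ ^ 2 / (4 * s) := by
    rw [norm_smul, Real.norm_of_nonneg (by positivity), mul_pow, inv_pow, Real.sq_sqrt hs.le]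
    field_simp
  rw [e1, e2, heatKernelD3, heatKernel, Real.mul_rpow (by positivity) hs.le, profile3]
  have e3 (i : Fin d) : ((Real.sqrt s)⁻¹ • x) i = (Real.sqrt s)⁻¹ * x i := by simp
  simp only [e3]
  generalize Real.sqrt s = r at *
  generalize hE : Real.exp (-‖x‖ ^ 2 / (4 * s)) = E
  generalize s ^ (-(d : ℝ) / 2) = S
  subst hss
  field_simp

/-- Gaussian bounds for the derivatives of the heat kernel that enter the kernel of
`e^{tΔ} ℙ div`, and for their increments. -/
lemma exists_heatKernel_bounds (d : ℕ) : ∃ A : ℝ, 0 < A ∧ ∀ (j h k : Fin d) (s : ℝ), 0 < s →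
    ∀ x : Space d,
      |heatKernelD1 h s x| ≤ A * s ^ (-((d : ℝ) + 1) / 2) * Real.exp (-(1 / 32 * ‖x‖ ^ 2 / s)) ∧
      |heatKernelD3 j h k s x| ≤
        A * s ^ (-((d : ℝ) + 3) / 2) * Real.exp (-(1 / 32 * ‖x‖ ^ 2 / s)) ∧
      ∀ y : Space d, ‖y‖ ≤ ‖x‖ / 2 →
        |heatKernelD1 h s (x - y) - heatKernelD1 h s x| ≤
          A * ‖y‖ * s ^ (-((d : ℝ) + 2) / 2) * Real.exp (-(1 / 32 * ‖x‖ ^ 2 / s)) ∧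
        |heatKernelD3 j h k s (x - y) - heatKernelD3 j h k s x| ≤
          A * ‖y‖ * s ^ (-((d : ℝ) + 4) / 2) * Real.exp (-(1 / 32 * ‖x‖ ^ 2 / s)) := by
  obtain ⟨A, hA, hprof⟩ := exists_profile_bound
  set B : ℝ := (4 * Real.pi) ^ (-(d : ℝ) / 2) with hB
  have hB0 : 0 < B := by have := Real.pi_pos; positivity
  refine ⟨B * A, by positivity, fun j h k s hs x => ?_⟩
  obtain ⟨p1, p1'⟩ := hprof d (profile1 h) (abs_profile1_le h) fun z w _ => abs_profile1_sub_le h z w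
  obtain ⟨p3, p3'⟩ := hprof d (profile3 j h k) (abs_profile3_le j h k) (abs_profile3_sub_le j h k)
  have hr : 0 < Real.sqrt s := Real.sqrt_pos.2 hs
  have hexp : -(1 / 32) * ‖(Real.sqrt s)⁻¹ • x‖ ^ 2 = -(1 / 32 * ‖x‖ ^ 2 / s) := by
    rw [norm_smul, Real.norm_of_nonneg (by positivity), mul_pow, inv_pow, Real.sq_sqrt hs.le]
    field_simp
  have hlow (y : Space d) (hy : ‖y‖ ≤ ‖x‖ / 2) :
      ‖(Real.sqrt s)⁻¹ • y‖ ≤ ‖(Real.sqrt s)⁻¹ • x‖ / 2 := by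
    rw [norm_smul, norm_smul, mul_div_assoc]; gcongr
  have hny (y : Space d) : ‖(Real.sqrt s)⁻¹ • y‖ = s ^ (-(1 / 2 : ℝ)) * ‖y‖ := by
    rw [norm_smul, Real.norm_of_nonneg (by positivity), Real.sqrt_eq_rpow, Real.rpow_neg hs.le]
  have hsc (ℓ : ℝ) : s ^ (-((d : ℝ) + ℓ + 1) / 2) = s ^ (-((d : ℝ) + ℓ) / 2) * s ^ (-(1 / 2 : ℝ)) := by
    rw [← Real.rpow_add hs]; congr 1; ring
  have hs1 := hsc 1
  have hs3 := hsc 3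
  rw [show (d : ℝ) + 1 + 1 = d + 2 by ring] at hs1
  rw [show (d : ℝ) + 3 + 1 = d + 4 by ring] at hs3
  have h0 (ℓ : ℝ) : 0 < s ^ ℓ := Real.rpow_pos_of_pos hs ℓ
  refine ⟨?_, ?_, fun y hy => ⟨?_, ?_⟩⟩
  · rw [heatKernelD1_eq_profile h hs, abs_mul, abs_of_pos (mul_pos hB0 (h0 _)), ← hexp]
    calc _ ≤ B * s ^ (-((d : ℝ) + 1) / 2) * (A * Real.exp (-(1 / 32) * ‖(Real.sqrt s)⁻¹ • x‖ ^ 2)) := by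
          have := h0 (-((d : ℝ) + 1) / 2)
          gcongr; exact p1 _
      _ = _ := by ring
  · rw [heatKernelD3_eq_profile j h k hs, abs_mul, abs_of_pos (mul_pos hB0 (h0 _)), ← hexp]
    calc _ ≤ B * s ^ (-((d : ℝ) + 3) / 2) * (A * Real.exp (-(1 / 32) * ‖(Real.sqrt s)⁻¹ • x‖ ^ 2)) := by
          have := h0 (-((d : ℝ) + 3) / 2)
          gcongr; exact p3 _
      _ = _ := by ring
  · rw [heatKernelD1_eq_profile h hs, heatKernelD1_eq_profile h hs, ← mul_sub, abs_mul,
      abs_of_pos (mul_pos hB0 (h0 _)), ← hexp, hs1, smul_sub]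
    have := p1' ((Real.sqrt s)⁻¹ • x) ((Real.sqrt s)⁻¹ • y) (hlow y hy)
    calc _ ≤ B * s ^ (-((d : ℝ) + 1) / 2) * (A * ‖(Real.sqrt s)⁻¹ • y‖ *
            Real.exp (-(1 / 32) * ‖(Real.sqrt s)⁻¹ • x‖ ^ 2)) := by
          have := h0 (-((d : ℝ) + 1) / 2)
          gcongr
      _ = _ := by rw [hny]; ring
  · rw [heatKernelD3_eq_profile j h k hs, heatKernelD3_eq_profile j h k hs, ← mul_sub, abs_mul,
      abs_of_pos (mul_pos hB0 (h0 _)), ← hexp, hs3, smul_sub]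
    have := p3' ((Real.sqrt s)⁻¹ • x) ((Real.sqrt s)⁻¹ • y) (hlow y hy)
    calc _ ≤ B * s ^ (-((d : ℝ) + 3) / 2) * (A * ‖(Real.sqrt s)⁻¹ • y‖ *
            Real.exp (-(1 / 32) * ‖(Real.sqrt s)⁻¹ • x‖ ^ 2)) := by
          have := h0 (-((d : ℝ) + 3) / 2)
          gcongr
      _ = _ := by rw [hny]; ring

/-! ### Time integrals -/

lemma integral_Ioi_rpow_mul_exp_neg_div {q c : ℝ} (hq : 0 < q) (hc : 0 < c) :
    ∫ s in Set.Ioi (0 : ℝ), s ^ (-q - 1) * Real.exp (-(c / s)) = c ^ (-q) * Real.Gamma q := by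
  -- The substitution `s ↦ s⁻¹` turns the integral into Euler's integral for `Γ`.
  rw [← integral_comp_rpow_Ioi _ (show (-1 : ℝ) ≠ 0 by norm_num), Real.rpow_neg hc.le,
    ← Real.inv_rpow hc.le, ← one_div, ← Real.integral_rpow_mul_exp_neg_mul_Ioi hq hc]
  refine setIntegral_congr_fun measurableSet_Ioi fun s hs => ?_
  have hs : 0 < s := hs
  simp only [smul_eq_mul, abs_neg, abs_one, one_mul]
  rw [← Real.rpow_mul hs.le, Real.rpow_neg_one, div_inv_eq_mul, ← mul_assoc, ← Real.rpow_add hs]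
  congr 2
  ring

lemma integrableOn_Ioi_rpow_mul_exp_neg_div {q c : ℝ} (hq : 0 < q) (hc : 0 < c) :
    IntegrableOn (fun s : ℝ => s ^ (-q - 1) * Real.exp (-(c / s))) (Set.Ioi 0) := by
  -- A function that is not integrable would have integral `0`, while this integral is positive.
  by_contra h
  have h1 := integral_Ioi_rpow_mul_exp_neg_div hq hc
  rw [integral_undef h] at h1
  have := Real.Gamma_pos_of_pos hq
  have : 0 < c ^ (-q) * Real.Gamma q := by positivity
  linarith

lemma rpow_neg_mul_exp_neg_div_le {q c τ : ℝ} (hq : 0 < q) (hc : 0 < c) (hτ : 0 < τ) :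
    τ ^ (-q) * Real.exp (-(c / τ)) ≤ q ^ q * c ^ (-q) := by
  have h1 : c / τ / q ≤ Real.exp (c / τ / q) := by
    linarith [Real.add_one_le_exp (c / τ / q)]
  have h2 : (c / τ / q) ^ q ≤ Real.exp (c / τ) := by
    calc _ ≤ Real.exp (c / τ / q) ^ q := Real.rpow_le_rpow (by positivity) h1 hq.le
      _ = _ := by rw [← Real.exp_mul]; congr 1; field_simp
  rw [Real.div_rpow (by positivity) hq.le, Real.div_rpow hc.le hτ.le] at h2
  rw [Real.exp_neg, Real.rpow_neg hτ.le, Real.rpow_neg hc.le, ← div_eq_mul_inv, ← div_eq_mul_inv,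
    div_le_div_iff₀ (Real.exp_pos _) (by positivity)]
  rw [div_div, div_le_iff₀ (by positivity)] at h2
  rw [inv_mul_le_iff₀ (by positivity)]
  linarith

/-- A boundary term and a time integral over `(τ, ∞)`, both of Gaussian size, are bounded by any
intermediate combination of powers of `c` and `τ`. -/
lemma abs_add_integral_Ioi_le {q a c B τ G₁ : ℝ} {G₃ : ℝ → ℝ} (hq : 0 < q) (ha : 0 ≤ a)
    (hc : 0 < c) (hB : 0 ≤ B) (hτ : 0 < τ)
    (h₁ : |G₁| ≤ B * τ ^ (-(q + a)) * Real.exp (-(c / τ)))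
    (h₃ : ∀ s, τ < s → |G₃ s| ≤ B * s ^ (-(q + a) - 1) * Real.exp (-(c / s))) :
    |G₁ + ∫ s in Set.Ioi τ, G₃ s| ≤ B * (q ^ q + Real.Gamma q) * c ^ (-q) * τ ^ (-a) := by
  have hτa : 0 < τ ^ (-a) := Real.rpow_pos_of_pos hτ _
  have i1 : |G₁| ≤ B * τ ^ (-a) * (q ^ q * c ^ (-q)) := by
    refine h₁.trans ?_
    rw [show -(q + a) = -a + -q by ring, Real.rpow_add hτ]
    calc _ = B * τ ^ (-a) * (τ ^ (-q) * Real.exp (-(c / τ))) := by ring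
      _ ≤ _ := mul_le_mul_of_nonneg_left (rpow_neg_mul_exp_neg_div_le hq hc hτ) (by positivity)
  have hint := integrableOn_Ioi_rpow_mul_exp_neg_div hq hc
  have i3 : |∫ s in Set.Ioi τ, G₃ s| ≤ B * τ ^ (-a) * (c ^ (-q) * Real.Gamma q) := by
    rw [← integral_Ioi_rpow_mul_exp_neg_div hq hc, ← integral_const_mul]
    calc |∫ s in Set.Ioi τ, G₃ s| ≤
          ∫ s in Set.Ioi τ, B * τ ^ (-a) * (s ^ (-q - 1) * Real.exp (-(c / s))) := by
          rw [← Real.norm_eq_abs]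
          refine norm_integral_le_of_norm_le
            ((hint.mono_set (Set.Ioi_subset_Ioi hτ.le)).const_mul _) ?_
          refine (ae_restrict_iff' measurableSet_Ioi).2 (Filter.Eventually.of_forall fun s hs => ?_)
          have hs : τ < s := hs
          have hs0 := hτ.trans hs
          refine (h₃ s hs).trans ?_
          rw [show -(q + a) - 1 = -a + (-q - 1) by ring, Real.rpow_add hs0]
          have : s ^ (-a) ≤ τ ^ (-a) :=
            Real.rpow_le_rpow_of_nonpos hτ hs.le (by linarith)
          calc _ = B * s ^ (-a) * (s ^ (-q - 1) * Real.exp (-(c / s))) := by ring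
            _ ≤ _ := by gcongr
      _ ≤ _ := by
          refine setIntegral_mono_set (hint.const_mul _) ?_
            (Set.Ioi_subset_Ioi hτ.le).eventuallyLE
          refine (ae_restrict_iff' measurableSet_Ioi).2 (Filter.Eventually.of_forall fun s hs => ?_)
          have hs : 0 < s := hs
          simp only [Pi.zero_apply]
          positivity
  calc _ ≤ _ := abs_add_le _ _
    _ ≤ _ := add_le_add i1 i3
    _ = _ := by ring

/-! ### Bounds for the kernel of `e^{tΔ} ℙ div` -/

lemma measurable_heatKernelD3 {d : ℕ} (j h k : Fin d) (x : Space d) :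
    Measurable fun s : ℝ => heatKernelD3 j h k s x := by
  unfold heatKernelD3 heatKernel; fun_prop

lemma abs_avg_kron_le {d : ℕ} (j h k : Fin d) {a b M : ℝ} (ha : |a| ≤ M) (hb : |b| ≤ M) :
    |1 / 2 * (kron j k * a + kron j h * b)| ≤ M := by
  have h1 := (abs_mul_kron_le a j k).trans ha
  have h2 := (abs_mul_kron_le b j h).trans hb
  rw [abs_le] at *
  constructor <;> linarith

lemma integrableOn_heatKernelD3 {d : ℕ} (j h k : Fin d) {x : Space d} (hx : x ≠ 0) :
    IntegrableOn (fun s : ℝ => heatKernelD3 j h k s x) (Set.Ioi 0) := by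
  obtain ⟨A, hA, hb⟩ := exists_heatKernel_bounds d
  have hn : 0 < ‖x‖ := norm_pos_iff.2 hx
  refine ((integrableOn_Ioi_rpow_mul_exp_neg_div (q := ((d : ℝ) + 1) / 2) (c := 1 / 32 * ‖x‖ ^ 2)
    (by positivity) (by positivity)).const_mul A).mono'
    (measurable_heatKernelD3 j h k x).aestronglyMeasurable
    ((ae_restrict_iff' measurableSet_Ioi).2 (Filter.Eventually.of_forall fun s hs => ?_))
  have := (hb j h k s hs x).2.1
  rw [Real.norm_eq_abs]
  refine this.trans_eq ?_
  rw [show -(((d : ℝ) + 1) / 2) - 1 = -((d : ℝ) + 3) / 2 by ring]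
  ring

lemma rpow_scale {n q : ℝ} (hn : 0 < n) : (1 / 32 * n ^ 2) ^ (-q) = 32 ^ q * n ^ (-(2 * q)) := by
  rw [Real.mul_rpow (by norm_num) (by positivity), ← Real.rpow_natCast n 2, ← Real.rpow_mul hn.le,
    one_div, Real.inv_rpow (by norm_num), Real.rpow_neg (by norm_num), inv_inv]
  congr 2; push_cast; ring

/-- Pointwise bounds for the kernel and for its increments: any weight `τ^{-(1-α)/2}` in time can
be traded for the corresponding power of `|x|`. -/
lemma exists_kernelF_bounds (d : ℕ) {α : ℝ} (hα0 : 0 ≤ α) (hα1 : α ≤ 1) :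
    ∃ K : ℝ, 0 < K ∧ ∀ (j h k : Fin d) (x : Space d), x ≠ 0 → ∀ τ : ℝ, 0 < τ →
      |kernelF j h k x τ| ≤ K * ‖x‖ ^ (-(d : ℝ) - α) * τ ^ (-((1 - α) / 2)) ∧
      ∀ y : Space d, ‖y‖ ≤ ‖x‖ / 2 → |kernelF j h k (x - y) τ - kernelF j h k x τ| ≤
        K * ‖y‖ * ‖x‖ ^ (-(d : ℝ) - 1 - α) * τ ^ (-((1 - α) / 2)) := by
  obtain ⟨A, hA, hb⟩ := exists_heatKernel_bounds d
  rcases Nat.eq_zero_or_pos d with rfl | hd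
  · exact ⟨1, one_pos, fun j => j.elim0⟩
  have hd' : (1 : ℝ) ≤ d := by exact_mod_cast hd
  set q₁ : ℝ := ((d : ℝ) + α) / 2 with hq₁
  set q₂ : ℝ := ((d : ℝ) + 1 + α) / 2 with hq₂
  have hq₁0 : 0 < q₁ := by positivity
  have hq₂0 : 0 < q₂ := by positivity
  have hG₁ := Real.Gamma_pos_of_pos hq₁0
  have hG₂ := Real.Gamma_pos_of_pos hq₂0
  set K₁ : ℝ := A * (q₁ ^ q₁ + Real.Gamma q₁) * 32 ^ q₁ with hK₁
  set K₂ : ℝ := A * (q₂ ^ q₂ + Real.Gamma q₂) * 32 ^ q₂ with hK₂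
  have hK₁0 : 0 < K₁ := by positivity
  have hK₂0 : 0 < K₂ := by positivity
  refine ⟨K₁ + K₂, by positivity, fun j h k x hx τ hτ => ⟨?_, fun y hy => ?_⟩⟩
  · have hn : 0 < ‖x‖ := norm_pos_iff.2 hx
    rw [kernelF_eq j h k x hτ]
    refine (abs_add_integral_Ioi_le (q := q₁) (a := (1 - α) / 2) (c := 1 / 32 * ‖x‖ ^ 2) (B := A)
      hq₁0 (by linarith) (by positivity) hA.le hτ ?_ fun s hs => ?_).trans ?_
    · rw [show -(q₁ + (1 - α) / 2) = -((d : ℝ) + 1) / 2 by rw [hq₁]; ring]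
      exact abs_avg_kron_le j h k (hb j h k τ hτ x).1 (hb j k k τ hτ x).1
    · rw [show -(q₁ + (1 - α) / 2) - 1 = -((d : ℝ) + 3) / 2 by rw [hq₁]; ring]
      exact (hb j h k s (hτ.trans hs) x).2.1
    · rw [rpow_scale hn, show -(2 * q₁) = -(d : ℝ) - α by rw [hq₁]; ring, ← mul_assoc, ← hK₁]
      gcongr
      linarith
  · have hn : 0 < ‖x‖ := norm_pos_iff.2 hx
    have hxy : x - y ≠ 0 := by
      intro h0
      rw [sub_eq_zero.1 h0] at hy hn
      linarith
    have ix := (integrableOn_heatKernelD3 j h k hx).mono_set (Set.Ioi_subset_Ioi hτ.le)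
    have ixy := (integrableOn_heatKernelD3 j h k hxy).mono_set (Set.Ioi_subset_Ioi hτ.le)
    have e : kernelF j h k (x - y) τ - kernelF j h k x τ =
        1 / 2 * (kron j k * (heatKernelD1 h τ (x - y) - heatKernelD1 h τ x) +
          kron j h * (heatKernelD1 k τ (x - y) - heatKernelD1 k τ x)) +
          ∫ s in Set.Ioi τ, (heatKernelD3 j h k s (x - y) - heatKernelD3 j h k s x) := by
      rw [integral_sub ixy ix, kernelF_eq j h k x hτ, kernelF_eq j h k (x - y) hτ]; ring
    rw [e]
    refine (abs_add_integral_Ioi_le (q := q₂) (a := (1 - α) / 2) (c := 1 / 32 * ‖x‖ ^ 2)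
      (B := A * ‖y‖) hq₂0 (by linarith) (by positivity) (by positivity) hτ ?_ fun s hs => ?_).trans ?_
    · rw [show -(q₂ + (1 - α) / 2) = -((d : ℝ) + 2) / 2 by rw [hq₂]; ring]
      exact abs_avg_kron_le j h k ((hb j h k τ hτ x).2.2 y hy).1 ((hb j k k τ hτ x).2.2 y hy).1
    · rw [show -(q₂ + (1 - α) / 2) - 1 = -((d : ℝ) + 4) / 2 by rw [hq₂]; ring]
      exact ((hb j h k s (hτ.trans hs) x).2.2 y hy).2
    · rw [rpow_scale hn, show -(2 * q₂) = -(d : ℝ) - 1 - α by rw [hq₂]; ring]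
      calc _ = K₂ * ‖y‖ * ‖x‖ ^ (-(d : ℝ) - 1 - α) * τ ^ (-((1 - α) / 2)) := by rw [hK₂]; ring
        _ ≤ _ := by gcongr; linarith

/-- The kernel of `e^{τΔ} ℙ div` has the decay of `(√τ + |x|)^{-d-1}`. -/
lemma exists_kernelF_decay (d : ℕ) : ∃ K : ℝ, 0 < K ∧ ∀ (j h k : Fin d) (x : Space d) (τ : ℝ),
    0 < τ → |kernelF j h k x τ| ≤ K * (Real.sqrt τ + ‖x‖) ^ (-((d : ℝ) + 1)) := by
  obtain ⟨A, hA, hb⟩ := exists_heatKernel_bounds d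
  obtain ⟨K, hK, hKb⟩ := exists_kernelF_bounds d (zero_le_one) le_rfl
  have hd : (0 : ℝ) < (d : ℝ) + 1 := by positivity
  set K' : ℝ := K + 3 * A with hK'
  refine ⟨K' * 2 ^ ((d : ℝ) + 1), by positivity, fun j h k x τ hτ => ?_⟩
  have hr : 0 < Real.sqrt τ := Real.sqrt_pos.2 hτ
  have hn := norm_nonneg x
  have conv (m : ℝ) (hm : 0 < m) (h2 : Real.sqrt τ + ‖x‖ ≤ 2 * m) :
      K' * m ^ (-((d : ℝ) + 1)) ≤
        K' * 2 ^ ((d : ℝ) + 1) * (Real.sqrt τ + ‖x‖) ^ (-((d : ℝ) + 1)) := by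
    have : (2 * m) ^ (-((d : ℝ) + 1)) ≤ (Real.sqrt τ + ‖x‖) ^ (-((d : ℝ) + 1)) :=
      Real.rpow_le_rpow_of_nonpos (by positivity) h2 (by linarith)
    rw [mul_assoc]
    gcongr
    calc m ^ (-((d : ℝ) + 1)) = 2 ^ ((d : ℝ) + 1) * (2 * m) ^ (-((d : ℝ) + 1)) := by
          rw [Real.mul_rpow (by norm_num) hm.le, ← mul_assoc, ← Real.rpow_add (by norm_num)]
          simp
      _ ≤ _ := by gcongr
  rcases le_total (Real.sqrt τ) ‖x‖ with hle | hle
  · have hx : x ≠ 0 := norm_pos_iff.1 (hr.trans_le hle)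
    have h1 := (hKb j h k x hx τ hτ).1
    simp only [sub_self, zero_div, neg_zero, Real.rpow_zero, mul_one] at h1
    refine h1.trans (le_trans ?_ (conv ‖x‖ (hr.trans_le hle) (by linarith)))
    rw [show -(d : ℝ) - 1 = -((d : ℝ) + 1) by ring]
    gcongr
    linarith
  · refine le_trans ?_ (conv (Real.sqrt τ) hr (by linarith))
    have e1 : Real.sqrt τ ^ (-((d : ℝ) + 1)) = τ ^ (-((d : ℝ) + 1) / 2) := by
      rw [Real.sqrt_eq_rpow, ← Real.rpow_mul hτ.le]; congr 1; ring
    have hexp (s : ℝ) (hs : 0 < s) : Real.exp (-(1 / 32 * ‖x‖ ^ 2 / s)) ≤ 1 :=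
      Real.exp_le_one_iff.2 (by rw [neg_nonpos]; positivity)
    have hpow (s p : ℝ) (hs : 0 < s) : 0 ≤ s ^ p := Real.rpow_nonneg hs.le p
    have b1 (h : Fin d) : |heatKernelD1 h τ x| ≤ A * τ ^ (-((d : ℝ) + 1) / 2) :=
      (hb j h k τ hτ x).1.trans (mul_le_of_le_one_right
        (mul_nonneg hA.le (hpow _ _ hτ)) (hexp τ hτ))
    have b3 : |∫ s in Set.Ioi τ, heatKernelD3 j h k s x| ≤ 2 * A * τ ^ (-((d : ℝ) + 1) / 2) := by
      have hlt : -((d : ℝ) + 3) / 2 < -1 := by linarith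
      rw [← Real.norm_eq_abs]
      refine (norm_integral_le_of_norm_le ((integrableOn_Ioi_rpow_of_lt hlt hτ).const_mul A)
        ((ae_restrict_iff' measurableSet_Ioi).2 (Filter.Eventually.of_forall fun s hs => ?_))).trans ?_
      · have hs0 : 0 < s := hτ.trans hs
        exact (hb j h k s hs0 x).2.1.trans (mul_le_of_le_one_right
          (mul_nonneg hA.le (hpow _ _ hs0)) (hexp s hs0))
      · rw [integral_const_mul, integral_Ioi_rpow_of_lt hlt hτ,
          show -((d : ℝ) + 3) / 2 + 1 = -((d : ℝ) + 1) / 2 by ring, neg_div, ← div_neg,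
          mul_comm 2 A, mul_assoc]
        gcongr
        rw [div_le_iff₀ (by linarith)]
        have := hpow τ (-((d : ℝ) + 1) / 2) hτ
        nlinarith
    rw [kernelF_eq j h k x hτ, e1]
    calc _ ≤ _ := abs_add_le _ _
      _ ≤ A * τ ^ (-((d : ℝ) + 1) / 2) + 2 * A * τ ^ (-((d : ℝ) + 1) / 2) :=
          add_le_add (abs_avg_kron_le j h k (b1 h) (b1 k)) b3
      _ = 3 * A * τ ^ (-((d : ℝ) + 1) / 2) := by ring
      _ ≤ _ := by
          have := hpow τ (-((d : ℝ) + 1) / 2) hτ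
          gcongr
          linarith

/-! ### The homogeneous part of the kernel -/

/-- The kernel of `ℙ div`, obtained at `t = 0` from the kernel of `e^{tΔ} ℙ div`; for `x ≠ 0` it is
`∂_j ∂_h ∂_k` of the fundamental solution of `-Δ`, homogeneous of degree `-d-1`. -/
noncomputable def homKernel {d : ℕ} (j h k : Fin d) (x : Space d) : ℝ :=
  ∫ s in Set.Ioi (0 : ℝ), heatKernelD3 j h k s x

/-- The kernel differs from its homogeneous part by a term that is Gaussian in `x/√τ`. -/
lemma exists_kernelF_sub_homKernel_bound (d : ℕ) : ∃ K : ℝ, 0 < K ∧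
    ∀ (j h k : Fin d) (x : Space d), x ≠ 0 → ∀ τ : ℝ, 0 < τ →
      |kernelF j h k x τ - homKernel j h k x| ≤
        K * ‖x‖ ^ (-(d : ℝ) - 1) * Real.exp (-(1 / 64 * ‖x‖ ^ 2 / τ)) := by
  obtain ⟨A, hA, hb⟩ := exists_heatKernel_bounds d
  set q : ℝ := ((d : ℝ) + 1) / 2 with hq
  have hq0 : 0 < q := by positivity
  have hG := Real.Gamma_pos_of_pos hq0
  refine ⟨A * (q ^ q + Real.Gamma q) * (2 ^ q * 32 ^ q), by positivity, fun j h k x hx τ hτ => ?_⟩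
  have hn : 0 < ‖x‖ := norm_pos_iff.2 hx
  -- Half of the Gaussian rate gives the factor `e^{-c/τ}`, the other half the convergence at `0`.
  set c : ℝ := 1 / 64 * ‖x‖ ^ 2 with hc
  have hc0 : 0 < c := by positivity
  have hsplit (s : ℝ) : Real.exp (-(1 / 32 * ‖x‖ ^ 2 / s)) =
      Real.exp (-(c / s)) * Real.exp (-(c / s)) := by
    rw [← Real.exp_add]; congr 1; rw [hc]; ring
  have hcq : c ^ (-q) = 2 ^ q * 32 ^ q * ‖x‖ ^ (-(d : ℝ) - 1) := by
    rw [hc, show 1 / 64 * ‖x‖ ^ 2 = 2⁻¹ * (1 / 32 * ‖x‖ ^ 2) by ring,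
      Real.mul_rpow (by norm_num) (by positivity), rpow_scale hn,
      Real.inv_rpow (by norm_num), Real.rpow_neg (by norm_num), inv_inv, hq,
      show -(2 * (((d : ℝ) + 1) / 2)) = -(d : ℝ) - 1 by ring, mul_assoc]
  have i0 := integrableOn_heatKernelD3 j h k hx
  have e : kernelF j h k x τ - homKernel j h k x =
      1 / 2 * (kron j k * heatKernelD1 h τ x + kron j h * heatKernelD1 k τ x) -
        ∫ s in Set.Ioc 0 τ, heatKernelD3 j h k s x := by
    rw [kernelF_eq j h k x hτ, homKernel, ← Set.Ioc_union_Ioi_eq_Ioi hτ.le,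
      setIntegral_union (Set.Ioc_disjoint_Ioi le_rfl) measurableSet_Ioi
        (i0.mono_set Set.Ioc_subset_Ioi_self) (i0.mono_set (Set.Ioi_subset_Ioi hτ.le))]
    ring
  have b1 (h : Fin d) : |heatKernelD1 h τ x| ≤ A * (q ^ q * c ^ (-q)) * Real.exp (-(c / τ)) := by
    refine (hb j h k τ hτ x).1.trans ?_
    rw [hsplit, show -((d : ℝ) + 1) / 2 = -q by rw [hq]; ring]
    calc _ = A * (τ ^ (-q) * Real.exp (-(c / τ))) * Real.exp (-(c / τ)) := by ring
      _ ≤ _ := mul_le_mul_of_nonneg_right (mul_le_mul_of_nonneg_left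
          (rpow_neg_mul_exp_neg_div_le hq0 hc0 hτ) hA.le) (Real.exp_pos _).le
  have hint := integrableOn_Ioi_rpow_mul_exp_neg_div hq0 hc0
  have b3 : |∫ s in Set.Ioc 0 τ, heatKernelD3 j h k s x| ≤
      A * Real.exp (-(c / τ)) * (c ^ (-q) * Real.Gamma q) := by
    rw [← integral_Ioi_rpow_mul_exp_neg_div hq0 hc0, ← integral_const_mul, ← Real.norm_eq_abs]
    refine (norm_integral_le_of_norm_le
      ((hint.mono_set Set.Ioc_subset_Ioi_self).const_mul (A * Real.exp (-(c / τ))))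
      ((ae_restrict_iff' measurableSet_Ioc).2 (Filter.Eventually.of_forall fun s hs => ?_))).trans ?_
    · have hs0 : 0 < s := hs.1
      refine (hb j h k s hs0 x).2.1.trans ?_
      rw [hsplit, show -((d : ℝ) + 3) / 2 = -q - 1 by rw [hq]; ring]
      have : Real.exp (-(c / s)) ≤ Real.exp (-(c / τ)) := by
        refine Real.exp_le_exp.2 (neg_le_neg ?_)
        exact div_le_div_of_nonneg_left hc0.le hs0 hs.2
      calc _ = A * Real.exp (-(c / s)) * (s ^ (-q - 1) * Real.exp (-(c / s))) := by ring
        _ ≤ _ := by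
            have := Real.rpow_nonneg hs0.le (-q - 1)
            gcongr
    · refine setIntegral_mono_set (hint.const_mul _) ?_ Set.Ioc_subset_Ioi_self.eventuallyLE
      refine (ae_restrict_iff' measurableSet_Ioi).2 (Filter.Eventually.of_forall fun s hs => ?_)
      have hs : 0 < s := hs
      simp only [Pi.zero_apply]
      positivity
  rw [e]
  calc _ ≤ _ := abs_sub _ _
    _ ≤ _ := add_le_add (abs_avg_kron_le j h k (b1 h) (b1 k)) b3
    _ = _ := by rw [hcq]; ring

/-- Explicit form of the homogeneous part of the kernel. -/
lemma homKernel_eq {d : ℕ} (j h k : Fin d) {x : Space d} (hx : x ≠ 0) :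
    homKernel j h k x = gammaConst d *
      ((x j * kron h k + x h * kron j k + x k * kron j h) * (‖x‖ ^ 2) ^ (-(d : ℝ) / 2 - 1) -
        (d + 2) * (x j * x h * x k) * (‖x‖ ^ 2) ^ (-(d : ℝ) / 2 - 2)) := by
  have hn : 0 < ‖x‖ ^ 2 := by positivity
  have hπ := Real.pi_pos
  set c : ℝ := ‖x‖ ^ 2 / 4 with hc
  have hc0 : 0 < c := by positivity
  set q : ℝ := (d : ℝ) / 2 + 1 with hq
  have hq0 : 0 < q := by positivity
  have hq1 : 0 < q + 1 := by positivity
  have e : homKernel j h k x = ∫ s in Set.Ioi (0 : ℝ),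
      ((4 * Real.pi) ^ (-(d : ℝ) / 2) * (-(x j * x h * x k) / 8) *
          (s ^ (-(q + 1) - 1) * Real.exp (-(c / s))) +
        (4 * Real.pi) ^ (-(d : ℝ) / 2) *
          ((x j * kron h k + x h * kron j k + x k * kron j h) / 4) *
          (s ^ (-q - 1) * Real.exp (-(c / s)))) := by
    refine setIntegral_congr_fun measurableSet_Ioi fun s hs => ?_
    have hs : 0 < s := hs
    have p1 : s ^ (-(q + 1) - 1) = s ^ (-(d : ℝ) / 2) * (s ^ 3)⁻¹ := by
      rw [← Real.rpow_natCast, ← Real.rpow_neg hs.le, ← Real.rpow_add hs]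
      congr 1; rw [hq]; push_cast; ring
    have p2 : s ^ (-q - 1) = s ^ (-(d : ℝ) / 2) * (s ^ 2)⁻¹ := by
      rw [← Real.rpow_natCast, ← Real.rpow_neg hs.le, ← Real.rpow_add hs]
      congr 1; rw [hq]; push_cast; ring
    have p3 : -‖x‖ ^ 2 / (4 * s) = -(c / s) := by rw [hc]; field_simp
    simp only [heatKernelD3, heatKernel]
    rw [p1, p2, p3, Real.mul_rpow (by positivity) hs.le]
    field_simp
  have c1 (p : ℝ) : c ^ (-p) = 4 ^ p * (‖x‖ ^ 2) ^ (-p) := by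
    rw [hc, Real.div_rpow hn.le (by norm_num), Real.rpow_neg (by norm_num : (0 : ℝ) ≤ 4),
      div_inv_eq_mul, mul_comm]
  have c2 : (4 : ℝ) ^ q = 4 ^ ((d : ℝ) / 2) * 4 := by
    rw [hq, Real.rpow_add (by norm_num), Real.rpow_one]
  have c3 : (4 : ℝ) ^ (q + 1) = 4 ^ ((d : ℝ) / 2) * 16 := by
    rw [Real.rpow_add (by norm_num), c2, Real.rpow_one]; ring
  have c4 : (4 * Real.pi) ^ (-(d : ℝ) / 2) =
      (4 ^ ((d : ℝ) / 2))⁻¹ * Real.pi ^ (-(d : ℝ) / 2) := by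
    rw [Real.mul_rpow (by norm_num) hπ.le, neg_div, Real.rpow_neg (by norm_num : (0 : ℝ) ≤ 4)]
  have c5 : (4 : ℝ) ^ ((d : ℝ) / 2) ≠ 0 := (Real.rpow_pos_of_pos (by norm_num) _).ne'
  have i1 := integrableOn_Ioi_rpow_mul_exp_neg_div hq1 hc0
  have i2 := integrableOn_Ioi_rpow_mul_exp_neg_div hq0 hc0
  rw [e, integral_add (i1.const_mul _) (i2.const_mul _), integral_const_mul, integral_const_mul,
    integral_Ioi_rpow_mul_exp_neg_div hq1 hc0, integral_Ioi_rpow_mul_exp_neg_div hq0 hc0,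
    Real.Gamma_add_one hq0.ne', c1, c1, c2, c3, c4, gammaConst,
    show ((d : ℝ) + 2) / 2 = q by rw [hq]; ring, show -(q + 1) = -(d : ℝ) / 2 - 2 by rw [hq]; ring,
    show -q = -(d : ℝ) / 2 - 1 by rw [hq]; ring]
  field_simp
  rw [hq]
  ring

/-! ### The gradient of the potential -/

lemma inv_norm_pow_eq {d : ℕ} (n : ℕ) (y : Space d) :
    (‖y‖ ^ n)⁻¹ = (‖y‖ ^ 2) ^ (-(n : ℝ) / 2) := by
  have : (‖y‖ ^ 2) ^ ((n : ℝ) / 2) = ‖y‖ ^ n := by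
    rw [← Real.rpow_natCast, ← Real.rpow_mul (norm_nonneg y), ← Real.rpow_natCast ‖y‖ n]
    congr 1; push_cast; ring
  rw [neg_div, Real.rpow_neg (by positivity), this]

lemma hasFDerivAt_norm_sq_rpow {d : ℕ} (p : ℝ) {x : Space d} (hx : x ≠ 0) :
    HasFDerivAt (fun y : Space d => (‖y‖ ^ 2) ^ p)
      ((p * (‖x‖ ^ 2) ^ (p - 1)) • (2 • innerSL ℝ x)) x := by
  have hn : ‖x‖ ^ 2 ≠ 0 := by positivity
  exact (hasStrictFDerivAt_norm_sq x).hasFDerivAt.rpow_const (Or.inl hn)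

lemma gradient_apply {d : ℕ} {f : Space d → ℝ} {x : Space d} (j : Fin d) :
    gradient f x j = fderiv ℝ f x (EuclideanSpace.single j 1) := by
  have h : inner ℝ (gradient f x) (EuclideanSpace.single j 1) =
      fderiv ℝ f x (EuclideanSpace.single j 1) := by
    rw [gradient, InnerProductSpace.toDual_symm_apply]
  rw [← h, EuclideanSpace.inner_single_right]
  simp

/-- The potential is built from the second derivatives of the fundamental solution, so that its
gradient is the homogeneous kernel contracted with the energy matrix. -/
lemma gradient_potential {d : ℕ} (hd : d ≠ 0) (u : ℝ → Space d → Space d) {x : Space d}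
    (hx : x ≠ 0) (t : ℝ) (j : Fin d) :
    gradient (fun y => potential u y t) x j =
      -∑ h, ∑ k, homKernel j h k x * energyMatrix u h k t := by
  have hd' : (d : ℝ) ≠ 0 := by exact_mod_cast hd
  have e : (fun y : Space d => potential u y t) = fun y => gammaConst d * ∑ h : Fin d, ∑ k : Fin d,
      (kron h k / d * (‖y‖ ^ 2) ^ (-(d : ℝ) / 2) -
        y h * y k * (‖y‖ ^ 2) ^ (-(d : ℝ) / 2 - 1)) * energyMatrix u h k t := by
    funext y
    rw [potential]
    congr 1
    refine Finset.sum_congr rfl fun h _ => Finset.sum_congr rfl fun k _ => ?_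
    congr 1
    have h1 := inv_norm_pow_eq d y
    have h2 := inv_norm_pow_eq (d + 2) y
    rw [show -((d + 2 : ℕ) : ℝ) / 2 = -(d : ℝ) / 2 - 1 by push_cast; ring] at h2
    rw [← h1, ← h2]
    ring
  have hc (h : Fin d) : HasFDerivAt (fun y : Space d => y h)
      (EuclideanSpace.proj h : Space d →L[ℝ] ℝ) x :=
    (EuclideanSpace.proj h : Space d →L[ℝ] ℝ).hasFDerivAt
  have hder := (HasFDerivAt.fun_sum (u := Finset.univ) fun h _ =>
    HasFDerivAt.fun_sum (u := Finset.univ) fun k _ =>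
      (((hasFDerivAt_norm_sq_rpow (-(d : ℝ) / 2) hx).const_mul (kron h k / d)).fun_sub
        (((hc h).fun_mul (hc k)).fun_mul
          (hasFDerivAt_norm_sq_rpow (-(d : ℝ) / 2 - 1) hx))).mul_const
          (energyMatrix u h k t)).const_mul (gammaConst d)
  have ek (h : Fin d) : (EuclideanSpace.single j (1 : ℝ)) h = kron j h := by
    simp [kron, eq_comm]
  have ei : (innerSL ℝ x) (EuclideanSpace.single j (1 : ℝ)) = x j := by
    simp [EuclideanSpace.inner_single_right]
  rw [gradient_apply, e, hder.fderiv, ← Finset.sum_neg_distrib]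
  simp only [smul_apply, sum_apply, sub_apply, add_apply, smul_eq_mul, Finset.mul_sum,
    PiLp.proj_apply, ek, ei, nsmul_eq_mul]
  refine Finset.sum_congr rfl fun h _ => ?_
  rw [← Finset.sum_neg_distrib]
  refine Finset.sum_congr rfl fun k _ => ?_
  rw [homKernel_eq j h k hx, show -(d : ℝ) / 2 - 1 - 1 = -(d : ℝ) / 2 - 2 by ring]
  push_cast
  field_simp
  ring

/-! ### Integral bounds in space -/

lemma integral_add_norm_rpow_neg {d : ℕ} {l p : ℝ} (hl : 0 < l) (x : Space d) :
    ∫ y : Space d, (l + ‖x - y‖) ^ (-p) =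
      l ^ ((d : ℝ) - p) * ∫ y : Space d, (1 + ‖y‖) ^ (-p) := by
  have h1 : ∫ y : Space d, (l + ‖x - y‖) ^ (-p) = ∫ y : Space d, (l + ‖y‖) ^ (-p) :=
    integral_sub_left_eq_self (fun y => (l + ‖y‖) ^ (-p)) volume x
  have h2 : (fun y : Space d => (l + ‖y‖) ^ (-p)) =
      fun y => l ^ (-p) * (1 + ‖l⁻¹ • y‖) ^ (-p) := by
    funext y
    rw [← Real.mul_rpow hl.le (by positivity), norm_smul, Real.norm_of_nonneg (by positivity)]
    congr 1
    field_simp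
  rw [h1, h2, integral_const_mul,
    Measure.integral_comp_inv_smul volume (fun y : Space d => (1 + ‖y‖) ^ (-p)) l,
    finrank_euclideanSpace_fin, abs_of_pos (by positivity), smul_eq_mul, ← mul_assoc,
    ← Real.rpow_natCast, ← Real.rpow_add hl]
  congr 2
  ring

lemma integrable_add_norm_rpow_neg {d : ℕ} {l p : ℝ} (hl : 0 < l) (hp : (d : ℝ) < p)
    (x : Space d) : Integrable fun y : Space d => (l + ‖x - y‖) ^ (-p) := by
  have h0 : Integrable fun y : Space d => (1 + ‖y‖) ^ (-p) :=
    integrable_one_add_norm (by simpa using hp)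
  have h1 : Integrable fun y : Space d => (l + ‖y‖) ^ (-p) := by
    refine ((h0.comp_smul (inv_ne_zero hl.ne')).const_mul (l ^ (-p))).congr
      (Filter.Eventually.of_forall fun y => ?_)
    simp only
    rw [← Real.mul_rpow hl.le (by positivity), norm_smul, Real.norm_of_nonneg (by positivity)]
    congr 1
    field_simp
  exact h1.comp_sub_left x

lemma measurable_kernelF_sub {d : ℕ} (j h k : Fin d) (x : Space d) :
    Measurable fun p : ℝ × Space d => kernelF j h k (x - p.2) p.1 := by
  have h1 : Measurable fun p : ℝ × Space d => (x - p.2, p.1) := by fun_prop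
  have h2 := (stronglyMeasurable_kernelF j h k).measurable.comp h1
  simpa only [Function.comp_def] using h2

lemma integrable_kernelF {d : ℕ} (j h k : Fin d) (x : Space d) {τ : ℝ} (hτ : 0 < τ) :
    Integrable fun y : Space d => kernelF j h k (x - y) τ := by
  obtain ⟨K, hK, hb⟩ := exists_kernelF_decay d
  refine ((integrable_add_norm_rpow_neg (Real.sqrt_pos.2 hτ) (lt_add_one (d : ℝ)) x).const_mul K).mono'
    ?_ (Filter.Eventually.of_forall fun y => hb j h k (x - y) τ hτ)
  have h1 : Measurable fun y : Space d => (τ, y) := by fun_prop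
  exact (Measurable.comp (g := fun p : ℝ × Space d => kernelF j h k (x - p.2) p.1)
    (measurable_kernelF_sub j h k x) h1).aestronglyMeasurable

lemma exists_integral_abs_kernelF_le (d : ℕ) : ∃ K : ℝ, 0 < K ∧
    ∀ (j h k : Fin d) (x : Space d) (τ : ℝ), 0 < τ →
      ∫ y : Space d, |kernelF j h k (x - y) τ| ≤ K * τ ^ (-(1 / 2 : ℝ)) := by
  obtain ⟨K, hK, hb⟩ := exists_kernelF_decay d
  set I : ℝ := ∫ y : Space d, (1 + ‖y‖) ^ (-((d : ℝ) + 1)) with hI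
  have hI0 : 0 ≤ I := integral_nonneg fun y => by positivity
  refine ⟨K * (I + 1), by positivity, fun j h k x τ hτ => ?_⟩
  calc _ ≤ ∫ y : Space d, K * (Real.sqrt τ + ‖x - y‖) ^ (-((d : ℝ) + 1)) :=
        integral_mono (integrable_kernelF j h k x hτ).abs
          ((integrable_add_norm_rpow_neg (Real.sqrt_pos.2 hτ) (lt_add_one (d : ℝ)) x).const_mul K)
          fun y => hb j h k (x - y) τ hτ
    _ = K * I * τ ^ (-(1 / 2 : ℝ)) := by
        rw [integral_const_mul, integral_add_norm_rpow_neg (Real.sqrt_pos.2 hτ), ← hI,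
          Real.sqrt_eq_rpow, ← Real.rpow_mul hτ.le,
          show (1 / 2 : ℝ) * ((d : ℝ) - ((d : ℝ) + 1)) = -(1 / 2 : ℝ) by ring]
        ring
    _ ≤ _ := by gcongr; linarith

/-! ### A beta-type integral in time -/

lemma intervalIntegrable_sub_rpow_neg {a : ℝ} (ha : a < 1) (t : ℝ) :
    IntervalIntegrable (fun s : ℝ => (t - s) ^ (-a)) volume 0 t := by
  have := (intervalIntegral.intervalIntegrable_rpow' (a := t) (b := 0) (r := -a)
    (by linarith)).comp_sub_left t
  simpa using this

lemma integral_sub_rpow_neg {a : ℝ} (ha : a < 1) (t : ℝ) :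
    ∫ s in (0 : ℝ)..t, (t - s) ^ (-a) = t ^ (1 - a) / (1 - a) := by
  rw [intervalIntegral.integral_comp_sub_left (fun s => s ^ (-a)) t,
    integral_rpow (Or.inl (by linarith)), sub_self, sub_zero, Real.zero_rpow (by linarith),
    show -a + 1 = 1 - a by ring, sub_zero]

lemma intervalIntegrable_one_add_rpow (r : ℝ) {t : ℝ} (ht : 0 ≤ t) :
    IntervalIntegrable (fun s : ℝ => (1 + s) ^ r) volume 0 t := by
  refine ContinuousOn.intervalIntegrable fun s hs => ?_
  rw [Set.uIcc_of_le ht] at hs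
  exact (ContinuousAt.rpow_const (by fun_prop)
    (Or.inl (by linarith [hs.1]))).continuousWithinAt

lemma integral_one_add_rpow {r t : ℝ} (ht : 0 ≤ t) (hr : r ≠ 0) :
    ∫ s in (0 : ℝ)..t, (1 + s) ^ (r - 1) = ((1 + t) ^ r - 1) / r := by
  rw [intervalIntegral.integral_comp_add_left (fun s => s ^ (r - 1)) 1,
    integral_rpow (Or.inr ⟨fun h => hr (by linarith), fun h => ?_⟩), sub_add_cancel, add_zero,
    Real.one_rpow]
  rw [Set.uIcc_of_le (by linarith)] at h
  linarith [h.1]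

lemma exists_integral_one_add_rpow_le {q b : ℝ} (hq : 0 ≤ q) (hqb : 1 - b < q) :
    ∃ C : ℝ, 0 < C ∧ ∀ t : ℝ, 1 ≤ t → ∫ s in (0 : ℝ)..t, (1 + s) ^ (-b) ≤ C * t ^ q := by
  rcases hq.eq_or_lt with rfl | hq
  · refine ⟨1 / (b - 1), one_div_pos.2 (by linarith), fun t ht => ?_⟩
    rw [show -b = (1 - b) - 1 by ring, integral_one_add_rpow (by linarith) (by linarith),
      Real.rpow_zero, mul_one, ← neg_div_neg_eq, neg_sub, neg_sub]
    have : 0 ≤ (1 + t) ^ (1 - b) := Real.rpow_nonneg (by linarith) _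
    exact div_le_div_of_nonneg_right (by linarith) (by linarith)
  · refine ⟨2 ^ q / q, by positivity, fun t ht => ?_⟩
    have ht0 : (0 : ℝ) ≤ t := by linarith
    calc _ ≤ ∫ s in (0 : ℝ)..t, (1 + s) ^ (q - 1) := by
          refine intervalIntegral.integral_mono_on ht0 (intervalIntegrable_one_add_rpow _ ht0)
            (intervalIntegrable_one_add_rpow _ ht0) fun s hs => ?_
          exact Real.rpow_le_rpow_of_exponent_le (by linarith [hs.1]) (by linarith)
      _ = ((1 + t) ^ q - 1) / q := integral_one_add_rpow ht0 hq.ne'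
      _ ≤ (2 * t) ^ q / q := by
          have : (1 + t) ^ q ≤ (2 * t) ^ q :=
            Real.rpow_le_rpow (by linarith) (by linarith) hq.le
          gcongr
          linarith
      _ = _ := by rw [Real.mul_rpow (by norm_num) ht0]; ring

lemma intervalIntegrable_sub_rpow_mul {a : ℝ} (ha : a < 1) (b : ℝ) {t : ℝ} (ht : 0 ≤ t) :
    IntervalIntegrable (fun s : ℝ => (t - s) ^ (-a) * (1 + s) ^ (-b)) volume 0 t := by
  refine (intervalIntegrable_sub_rpow_neg ha t).mul_continuousOn fun s hs => ?_
  rw [Set.uIcc_of_le ht] at hs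
  exact (ContinuousAt.rpow_const (by fun_prop)
    (Or.inl (by linarith [hs.1]))).continuousWithinAt

/-- Either `s ≤ t/2`, where `t - s` is comparable to `t`, or `s ≥ t/2`, where `1 + s` is. -/
lemma exists_integral_sub_rpow_mul_le {a b p : ℝ} (ha0 : 0 ≤ a) (ha : a < 1) (hb : 0 ≤ b)
    (hp : -a ≤ p) (hp' : 1 - a - b < p) :
    ∃ C : ℝ, 0 < C ∧ ∀ t : ℝ, 1 ≤ t →
      ∫ s in (0 : ℝ)..t, (t - s) ^ (-a) * (1 + s) ^ (-b) ≤ C * t ^ p := by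
  obtain ⟨C, hC, hCb⟩ := exists_integral_one_add_rpow_le (q := p + a) (b := b)
    (by linarith) (by linarith)
  have ha1 : 0 < 1 - a := by linarith
  refine ⟨2 ^ a * C + 2 ^ b / (1 - a), by positivity, fun t ht => ?_⟩
  have ht0 : (0 : ℝ) < t := by linarith
  have half (r : ℝ) : (t / 2) ^ (-r) = 2 ^ r * t ^ (-r) := by
    rw [Real.div_rpow ht0.le (by norm_num), Real.rpow_neg (by norm_num : (0 : ℝ) ≤ 2),
      div_inv_eq_mul, mul_comm]
  have i1 := (intervalIntegrable_one_add_rpow (-b) ht0.le).const_mul ((t / 2) ^ (-a))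
  have i2 := (intervalIntegrable_sub_rpow_neg ha t).const_mul ((t / 2) ^ (-b))
  calc _ ≤ ∫ s in (0 : ℝ)..t,
        ((t / 2) ^ (-a) * (1 + s) ^ (-b) + (t / 2) ^ (-b) * (t - s) ^ (-a)) := by
        refine intervalIntegral.integral_mono_on_of_le_Ioo ht0.le
          (intervalIntegrable_sub_rpow_mul ha b ht0.le) (i1.add i2) fun s hs => ?_
        have h1 : 0 ≤ (1 + s) ^ (-b) := Real.rpow_nonneg (by linarith [hs.1]) _
        have h2 : 0 ≤ (t - s) ^ (-a) := Real.rpow_nonneg (by linarith [hs.2]) _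
        have h3 : 0 ≤ (t / 2) ^ (-a) := Real.rpow_nonneg (by linarith) _
        have h4 : 0 ≤ (t / 2) ^ (-b) := Real.rpow_nonneg (by linarith) _
        rcases le_total s (t / 2) with h | h
        · have : (t - s) ^ (-a) ≤ (t / 2) ^ (-a) :=
            Real.rpow_le_rpow_of_nonpos (by linarith) (by linarith) (by linarith)
          nlinarith [mul_le_mul_of_nonneg_right this h1, mul_nonneg h4 h2]
        · have : (1 + s) ^ (-b) ≤ (t / 2) ^ (-b) :=
            Real.rpow_le_rpow_of_nonpos (by linarith) (by linarith) (by linarith)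
          nlinarith [mul_le_mul_of_nonneg_right this h2, mul_nonneg h3 h1]
    _ = (t / 2) ^ (-a) * (∫ s in (0 : ℝ)..t, (1 + s) ^ (-b)) +
          (t / 2) ^ (-b) * (t ^ (1 - a) / (1 - a)) := by
        rw [intervalIntegral.integral_add i1 i2, intervalIntegral.integral_const_mul,
          intervalIntegral.integral_const_mul, integral_sub_rpow_neg ha]
    _ ≤ 2 ^ a * t ^ (-a) * (C * t ^ (p + a)) + 2 ^ b * t ^ (-b) * (t ^ (1 - a) / (1 - a)) := by
        rw [half, half]
        gcongr
        exact hCb t ht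
    _ = 2 ^ a * C * t ^ p + 2 ^ b / (1 - a) * t ^ (1 - a - b) := by
        have e1 : t ^ p = t ^ (-a) * t ^ (p + a) := by
          rw [← Real.rpow_add ht0]; congr 1; ring
        have e2 : t ^ (1 - a - b) = t ^ (-b) * t ^ (1 - a) := by
          rw [← Real.rpow_add ht0]; congr 1; ring
        rw [e1, e2]
        ring
    _ ≤ 2 ^ a * C * t ^ p + 2 ^ b / (1 - a) * t ^ p := by
        gcongr 2 ^ a * C * t ^ p + 2 ^ b / (1 - a) * ?_
        exact Real.rpow_le_rpow_of_exponent_le ht hp'.le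
    _ = _ := by ring

/-! ### Convolutions with space-time decaying functions -/

/-- A measurable function on `[0,∞) × ℝ^d` with the decay of `(√(1+s) + |y|)^{-2m}`, which is that
of the products `u_h u_k`. -/
structure SpaceTimeDecay {d : ℕ} (m B : ℝ) (w : ℝ → Space d → ℝ) : Prop where
  measurable : Measurable fun p : ℝ × Space d => w p.1 p.2
  bound : ∀ s : ℝ, 0 ≤ s → ∀ᵐ y : Space d,
    |w s y| ≤ B * (Real.sqrt (1 + s) + ‖y‖) ^ (-(2 * m))

namespace SpaceTimeDecay

variable {d : ℕ} {m B : ℝ} {w : ℝ → Space d → ℝ}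

lemma measurable_apply (hw : SpaceTimeDecay m B w) (s : ℝ) : Measurable (w s) := by
  have h1 : Measurable fun y : Space d => (s, y) := by fun_prop
  have := hw.measurable.comp h1
  simpa only [Function.comp_def] using this

lemma nonneg (hw : SpaceTimeDecay m B w) : 0 ≤ B := by
  obtain ⟨y, hy⟩ := (hw.bound 0 le_rfl).exists
  have h1 : 0 < (Real.sqrt (1 + 0) + ‖y‖) ^ (-(2 * m)) := by
    have : 0 < Real.sqrt (1 + 0 : ℝ) := Real.sqrt_pos.2 (by norm_num)
    positivity
  exact nonneg_of_mul_nonneg_left ((abs_nonneg _).trans hy) h1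

lemma sqrt_one_add_pos {s : ℝ} (hs : 0 ≤ s) : 0 < Real.sqrt (1 + s) :=
  Real.sqrt_pos.2 (by linarith)

lemma integrable_bound (hm : (d : ℝ) < 2 * m) {s : ℝ} (hs : 0 ≤ s) :
    Integrable fun y : Space d => (Real.sqrt (1 + s) + ‖y‖) ^ (-(2 * m)) := by
  simpa using integrable_add_norm_rpow_neg (sqrt_one_add_pos hs) hm (0 : Space d)

lemma integrable (hw : SpaceTimeDecay m B w) (hm : (d : ℝ) < 2 * m) {s : ℝ} (hs : 0 ≤ s) :
    Integrable (w s) :=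
  ((integrable_bound hm hs).const_mul B).mono' (hw.measurable_apply s).aestronglyMeasurable
    (hw.bound s hs)

lemma norm_mul_bound (hw : SpaceTimeDecay m B w) {s : ℝ} (hs : 0 ≤ s) :
    ∀ᵐ y : Space d, ‖y‖ * |w s y| ≤ B * (Real.sqrt (1 + s) + ‖y‖) ^ (-(2 * m - 1)) := by
  have hl := sqrt_one_add_pos hs
  filter_upwards [hw.bound s hs] with y hy
  have hpos : 0 < Real.sqrt (1 + s) + ‖y‖ := by positivity
  calc _ ≤ (Real.sqrt (1 + s) + ‖y‖) * (B * (Real.sqrt (1 + s) + ‖y‖) ^ (-(2 * m))) := by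
        gcongr; linarith
    _ = _ := by
        rw [show -(2 * m - 1) = 1 + -(2 * m) by ring, Real.rpow_add hpos, Real.rpow_one]; ring

lemma integrable_norm_mul (hw : SpaceTimeDecay m B w) (hm : (d : ℝ) + 1 < 2 * m) {s : ℝ}
    (hs : 0 ≤ s) : Integrable fun y : Space d => ‖y‖ * |w s y| := by
  have h0 := integrable_add_norm_rpow_neg (sqrt_one_add_pos hs)
    (show (d : ℝ) < 2 * m - 1 by linarith) (0 : Space d)
  simp only [zero_sub, norm_neg] at h0
  refine (h0.const_mul B).mono'
    (measurable_norm.mul (hw.measurable_apply s).abs).aestronglyMeasurable ?_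
  filter_upwards [hw.norm_mul_bound hs] with y hy
  rwa [Real.norm_of_nonneg (by positivity)]

lemma sqrt_rpow {s : ℝ} (hs : 0 ≤ s) (p : ℝ) :
    Real.sqrt (1 + s) ^ p = (1 + s) ^ (p / 2) := by
  rw [Real.sqrt_eq_rpow, ← Real.rpow_mul (by linarith)]; congr 1; ring

/-- First moments decay in time. -/
lemma integral_norm_mul_le (hw : SpaceTimeDecay m B w) (hm : (d : ℝ) + 1 < 2 * m) {s : ℝ}
    (hs : 0 ≤ s) : ∫ y : Space d, ‖y‖ * |w s y| ≤
      B * (∫ y : Space d, (1 + ‖y‖) ^ (-(2 * m - 1))) * (1 + s) ^ (-(m - ((d : ℝ) + 1) / 2)) := by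
  have hl := sqrt_one_add_pos hs
  have h0 := integrable_add_norm_rpow_neg hl
    (show (d : ℝ) < 2 * m - 1 by linarith) (0 : Space d)
  have h1 := integral_add_norm_rpow_neg (p := 2 * m - 1) hl (0 : Space d)
  simp only [zero_sub, norm_neg] at h0 h1
  calc _ ≤ ∫ y : Space d, B * (Real.sqrt (1 + s) + ‖y‖) ^ (-(2 * m - 1)) :=
        integral_mono_ae (hw.integrable_norm_mul hm hs) (h0.const_mul B) (hw.norm_mul_bound hs)
    _ = _ := by
        rw [integral_const_mul, h1, sqrt_rpow hs,
          show ((d : ℝ) - (2 * m - 1)) / 2 = -(m - ((d : ℝ) + 1) / 2) by ring]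
        ring

lemma bound_one (hw : SpaceTimeDecay m B w) (hm : 0 < m) {s : ℝ} (hs : 0 ≤ s) :
    ∀ᵐ y : Space d, |w s y| ≤ B * (1 + ‖y‖) ^ (-(2 * m)) := by
  have hB := hw.nonneg
  filter_upwards [hw.bound s hs] with y hy
  refine hy.trans (mul_le_mul_of_nonneg_left ?_ hB)
  refine Real.rpow_le_rpow_of_nonpos (by positivity) ?_ (by linarith)
  have : 1 ≤ Real.sqrt (1 + s) := Real.one_le_sqrt.2 (by linarith)
  linarith

lemma bound_const (hw : SpaceTimeDecay m B w) (hm : 0 < m) {s : ℝ} (hs : 0 ≤ s) :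
    ∀ᵐ y : Space d, |w s y| ≤ B := by
  have hB := hw.nonneg
  filter_upwards [hw.bound_one hm hs] with y hy
  refine hy.trans (mul_le_of_le_one_right hB ?_)
  exact Real.rpow_le_one_of_one_le_of_nonpos (by linarith [norm_nonneg y]) (by linarith)

lemma abs_integral_le (hw : SpaceTimeDecay m B w) (hm0 : 0 < m) (hm : (d : ℝ) < 2 * m) {s : ℝ}
    (hs : 0 ≤ s) : |∫ y, w s y| ≤ B * ∫ y : Space d, (1 + ‖y‖) ^ (-(2 * m)) := by
  rw [← integral_const_mul, ← Real.norm_eq_abs]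
  exact norm_integral_le_of_norm_le
    ((integrable_one_add_norm (by simpa using hm)).const_mul B) (hw.bound_one hm0 hs)

lemma measurable_integral (hw : SpaceTimeDecay m B w) : Measurable fun s => ∫ y, w s y :=
  (StronglyMeasurable.integral_prod_right (f := w) hw.measurable.stronglyMeasurable).measurable

lemma intervalIntegrable_integral (hw : SpaceTimeDecay m B w) (hm0 : 0 < m)
    (hm : (d : ℝ) < 2 * m) {t : ℝ} (ht : 0 ≤ t) :
    IntervalIntegrable (fun s => ∫ y, w s y) volume 0 t := by
  refine (intervalIntegrable_const (c := B * ∫ y : Space d, (1 + ‖y‖) ^ (-(2 * m)))).mono_fun'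
    hw.measurable_integral.aestronglyMeasurable ?_
  refine (ae_restrict_iff' measurableSet_uIoc).2 (Filter.Eventually.of_forall fun s hs => ?_)
  rw [Set.uIoc_of_le ht] at hs
  exact hw.abs_integral_le hm0 hm hs.1.le

lemma integrable_kernelF_mul (hw : SpaceTimeDecay m B w) (hm0 : 0 < m) (j h k : Fin d)
    (x : Space d) {s τ : ℝ} (hs : 0 ≤ s) (hτ : 0 < τ) :
    Integrable fun y => kernelF j h k (x - y) τ * w s y :=
  (integrable_kernelF j h k x hτ).mul_bdd (hw.measurable_apply s).aestronglyMeasurable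
    (hw.bound_const hm0 hs)

lemma measurable_kernelF_time (j h k : Fin d) (x : Space d) (t : ℝ) :
    Measurable fun s : ℝ => kernelF j h k x (t - s) := by
  have h1 : Measurable fun s : ℝ => (x, t - s) := by fun_prop
  have h2 := (stronglyMeasurable_kernelF j h k).measurable.comp h1
  simpa only [Function.comp_def] using h2

lemma measurable_integral_kernelF_mul (hw : SpaceTimeDecay m B w) (j h k : Fin d) (x : Space d)
    (t : ℝ) : Measurable fun s => ∫ y, kernelF j h k (x - y) (t - s) * w s y := by
  have h1 : Measurable fun p : ℝ × Space d => (t - p.1, p.2) := by fun_prop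
  have h2 := (measurable_kernelF_sub j h k x).comp h1
  have h3 : Measurable fun p : ℝ × Space d => kernelF j h k (x - p.2) (t - p.1) * w p.1 p.2 := by
    simp only [Function.comp_def] at h2
    exact h2.mul hw.measurable
  exact (StronglyMeasurable.integral_prod_right
    (f := fun (s : ℝ) (y : Space d) => kernelF j h k (x - y) (t - s) * w s y)
    h3.stronglyMeasurable).measurable

lemma intervalIntegrable_integral_kernelF_mul (hw : SpaceTimeDecay m B w) (hm0 : 0 < m)
    (j h k : Fin d) (x : Space d) {t : ℝ} (ht : 0 ≤ t) :
    IntervalIntegrable (fun s => ∫ y, kernelF j h k (x - y) (t - s) * w s y) volume 0 t := by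
  obtain ⟨K, hK, hKb⟩ := exists_integral_abs_kernelF_le d
  have hB := hw.nonneg
  refine ((intervalIntegrable_sub_rpow_neg (a := 1 / 2) (by norm_num) t).const_mul (K * B)).mono_fun'
    (hw.measurable_integral_kernelF_mul j h k x t).aestronglyMeasurable ?_
  rw [Set.uIoc_of_le ht, Measure.restrict_congr_set Ioo_ae_eq_Ioc.symm]
  refine (ae_restrict_iff' measurableSet_Ioo).2 (Filter.Eventually.of_forall fun s hs => ?_)
  have hτ : 0 < t - s := sub_pos.2 hs.2
  refine (norm_integral_le_of_norm_le ((integrable_kernelF j h k x hτ).abs.mul_const B) ?_).trans ?_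
  · filter_upwards [hw.bound_const hm0 hs.1.le] with y hy
    rw [norm_mul, Real.norm_eq_abs, Real.norm_eq_abs]
    gcongr
  · rw [integral_mul_const]
    calc _ ≤ K * (t - s) ^ (-(1 / 2 : ℝ)) * B := by gcongr; exact hKb j h k x _ hτ
      _ = _ := by ring

lemma intervalIntegrable_kernelF_mul_integral (hw : SpaceTimeDecay m B w) (hm0 : 0 < m)
    (hm : (d : ℝ) < 2 * m) (j h k : Fin d) {x : Space d} (hx : x ≠ 0) {t : ℝ} (ht : 0 ≤ t) :
    IntervalIntegrable (fun s => kernelF j h k x (t - s) * ∫ y, w s y) volume 0 t := by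
  obtain ⟨K, hK, hKb⟩ := exists_kernelF_bounds d (zero_le_one) le_rfl
  refine (intervalIntegrable_const (c := K * ‖x‖ ^ (-(d : ℝ) - 1) *
    (B * ∫ y : Space d, (1 + ‖y‖) ^ (-(2 * m))))).mono_fun'
    ((measurable_kernelF_time j h k x t).mul hw.measurable_integral).aestronglyMeasurable ?_
  rw [Set.uIoc_of_le ht, Measure.restrict_congr_set Ioo_ae_eq_Ioc.symm]
  refine (ae_restrict_iff' measurableSet_Ioo).2 (Filter.Eventually.of_forall fun s hs => ?_)
  have h1 := (hKb j h k x hx (t - s) (sub_pos.2 hs.2)).1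
  simp only [sub_self, zero_div, neg_zero, Real.rpow_zero, mul_one] at h1
  simp only [norm_mul]
  gcongr
  · exact h1
  · exact hw.abs_integral_le hm0 hm hs.1.le

/-! ### The remainder -/

/-- The pointwise comparison behind the remainder estimate. For `|y| ≤ |x|/2` the increment of the
kernel is controlled by its gradient; for `|y| > |x|/2` the term `F(x)` is paid for by `|y|/|x|`,
and the term `F(x-y)` by the decay of `w` at the point `y`. -/
lemma abs_kernelF_sub_mul_le {α K : ℝ} (hα0 : 0 ≤ α) (hα : (d : ℝ) + 1 + α ≤ 2 * m)
    (hK : 0 ≤ K) (hB : 0 ≤ B) (j h k : Fin d) {x : Space d} (hx : x ≠ 0) {τ l : ℝ} (hτ : 0 < τ)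
    (hl : 0 < l) (y : Space d) {v : ℝ} (hv : |v| ≤ B * (l + ‖y‖) ^ (-(2 * m)))
    (h1 : |kernelF j h k x τ| ≤ K * ‖x‖ ^ (-(d : ℝ) - α) * τ ^ (-((1 - α) / 2)))
    (h2 : ‖y‖ ≤ ‖x‖ / 2 → |kernelF j h k (x - y) τ - kernelF j h k x τ| ≤
      K * ‖y‖ * ‖x‖ ^ (-(d : ℝ) - 1 - α) * τ ^ (-((1 - α) / 2))) :
    |(kernelF j h k (x - y) τ - kernelF j h k x τ) * v| ≤
      ‖x‖ ^ (-(d : ℝ) - 1 - α) * (2 * K * τ ^ (-((1 - α) / 2)) * (‖y‖ * |v|) +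
        B * 2 ^ ((d : ℝ) + 1 + α) * l ^ (-(2 * m - (d : ℝ) - 1 - α)) *
          |kernelF j h k (x - y) τ|) := by
  have hn : 0 < ‖x‖ := norm_pos_iff.2 hx
  have hX : 0 < ‖x‖ ^ (-(d : ℝ) - 1 - α) := Real.rpow_pos_of_pos hn _
  have hT : 0 < τ ^ (-((1 - α) / 2)) := Real.rpow_pos_of_pos hτ _
  have hL : 0 < l ^ (-(2 * m - (d : ℝ) - 1 - α)) := Real.rpow_pos_of_pos hl _
  rw [abs_mul]
  rcases le_or_gt ‖y‖ (‖x‖ / 2) with hy | hy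
  · calc _ ≤ K * ‖y‖ * ‖x‖ ^ (-(d : ℝ) - 1 - α) * τ ^ (-((1 - α) / 2)) * |v| := by
          gcongr; exact h2 hy
      _ = ‖x‖ ^ (-(d : ℝ) - 1 - α) * (K * τ ^ (-((1 - α) / 2)) * (‖y‖ * |v|) + 0) := by ring
      _ ≤ _ := by
          gcongr
          · linarith
          · positivity
  · have e1 : ‖x‖ ^ (-(d : ℝ) - α) = ‖x‖ ^ (-(d : ℝ) - 1 - α) * ‖x‖ := by
      rw [← Real.rpow_add_one hn.ne']; congr 1; ring
    have b1 : |kernelF j h k x τ| ≤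
        2 * K * ‖x‖ ^ (-(d : ℝ) - 1 - α) * τ ^ (-((1 - α) / 2)) * ‖y‖ := by
      refine h1.trans ?_
      rw [e1]
      calc _ = K * ‖x‖ ^ (-(d : ℝ) - 1 - α) * τ ^ (-((1 - α) / 2)) * ‖x‖ := by ring
        _ ≤ K * ‖x‖ ^ (-(d : ℝ) - 1 - α) * τ ^ (-((1 - α) / 2)) * (2 * ‖y‖) := by
            gcongr; linarith
        _ = _ := by ring
    have hpos : 0 < l + ‖y‖ := by positivity
    have b2 : |v| ≤ B * 2 ^ ((d : ℝ) + 1 + α) * l ^ (-(2 * m - (d : ℝ) - 1 - α)) *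
        ‖x‖ ^ (-(d : ℝ) - 1 - α) := by
      refine hv.trans ?_
      have e2 : (l + ‖y‖) ^ (-(2 * m)) =
          (l + ‖y‖) ^ (-(d : ℝ) - 1 - α) * (l + ‖y‖) ^ (-(2 * m - (d : ℝ) - 1 - α)) := by
        rw [← Real.rpow_add hpos]; congr 1; ring
      have e3 : (l + ‖y‖) ^ (-(d : ℝ) - 1 - α) ≤ (‖x‖ / 2) ^ (-(d : ℝ) - 1 - α) :=
        Real.rpow_le_rpow_of_nonpos (by positivity) (by linarith)
          (by have : (0 : ℝ) ≤ d := by positivity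
              linarith)
      have e4 : (l + ‖y‖) ^ (-(2 * m - (d : ℝ) - 1 - α)) ≤ l ^ (-(2 * m - (d : ℝ) - 1 - α)) :=
        Real.rpow_le_rpow_of_nonpos hl (by linarith [norm_nonneg y]) (by linarith)
      have e5 : (‖x‖ / 2) ^ (-(d : ℝ) - 1 - α) =
          2 ^ ((d : ℝ) + 1 + α) * ‖x‖ ^ (-(d : ℝ) - 1 - α) := by
        rw [Real.div_rpow hn.le (by norm_num),
          show -(d : ℝ) - 1 - α = -((d : ℝ) + 1 + α) by ring,
          Real.rpow_neg (by norm_num : (0 : ℝ) ≤ 2), div_inv_eq_mul, mul_comm]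
      calc _ = B * ((l + ‖y‖) ^ (-(d : ℝ) - 1 - α) *
            (l + ‖y‖) ^ (-(2 * m - (d : ℝ) - 1 - α))) := by rw [e2]
        _ ≤ B * ((‖x‖ / 2) ^ (-(d : ℝ) - 1 - α) * l ^ (-(2 * m - (d : ℝ) - 1 - α))) := by
            gcongr
        _ = _ := by rw [e5]; ring
    calc _ ≤ (|kernelF j h k (x - y) τ| + |kernelF j h k x τ|) * |v| := by
          gcongr; exact abs_sub _ _
      _ = |kernelF j h k x τ| * |v| + |kernelF j h k (x - y) τ| * |v| := by ring
      _ ≤ (2 * K * ‖x‖ ^ (-(d : ℝ) - 1 - α) * τ ^ (-((1 - α) / 2)) * ‖y‖) * |v| +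
          |kernelF j h k (x - y) τ| * (B * 2 ^ ((d : ℝ) + 1 + α) *
            l ^ (-(2 * m - (d : ℝ) - 1 - α)) * ‖x‖ ^ (-(d : ℝ) - 1 - α)) := by
          gcongr
      _ = _ := by ring

/-- Replacing `F(x-y)` by `F(x)` in the convolution, at a fixed time. -/
lemma exists_abs_integral_kernelF_sub_le (d : ℕ) {m α : ℝ} (hm0 : 0 < m)
    (hm : (d : ℝ) + 1 < 2 * m) (hα0 : 0 ≤ α) (hα1 : α ≤ 1) (hα : (d : ℝ) + 1 + α ≤ 2 * m) :
    ∃ K : ℝ, 0 < K ∧ ∀ (B : ℝ) (w : ℝ → Space d → ℝ), SpaceTimeDecay m B w →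
      ∀ (j h k : Fin d) (x : Space d), x ≠ 0 → ∀ s τ : ℝ, 0 ≤ s → 0 < τ →
        |(∫ y, kernelF j h k (x - y) τ * w s y) - kernelF j h k x τ * ∫ y, w s y| ≤
          K * B * ‖x‖ ^ (-(d : ℝ) - 1 - α) *
            (τ ^ (-((1 - α) / 2)) * (1 + s) ^ (-(m - ((d : ℝ) + 1) / 2)) +
              τ ^ (-(1 / 2 : ℝ)) * (1 + s) ^ (-(m - ((d : ℝ) + 1 + α) / 2))) := by
  obtain ⟨K₁, hK₁, hb₁⟩ := exists_kernelF_bounds d hα0 hα1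
  obtain ⟨K₂, hK₂, hb₂⟩ := exists_integral_abs_kernelF_le d
  set I : ℝ := ∫ y : Space d, (1 + ‖y‖) ^ (-(2 * m - 1)) with hI
  have hI0 : 0 ≤ I := integral_nonneg fun y => by positivity
  set P : ℝ := 2 ^ ((d : ℝ) + 1 + α) with hP
  have hP0 : 0 < P := by positivity
  refine ⟨2 * K₁ * I + P * K₂, by positivity, fun B w hw j h k x hx s τ hs hτ => ?_⟩
  have hB := hw.nonneg
  have hn : 0 < ‖x‖ := norm_pos_iff.2 hx
  have hl := sqrt_one_add_pos hs
  have hX : 0 < ‖x‖ ^ (-(d : ℝ) - 1 - α) := Real.rpow_pos_of_pos hn _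
  have hT : 0 < τ ^ (-((1 - α) / 2)) := Real.rpow_pos_of_pos hτ _
  have hT' : 0 < τ ^ (-(1 / 2 : ℝ)) := Real.rpow_pos_of_pos hτ _
  have hS : 0 < (1 + s) ^ (-(m - ((d : ℝ) + 1) / 2)) := Real.rpow_pos_of_pos (by linarith) _
  have hS' : 0 < (1 + s) ^ (-(m - ((d : ℝ) + 1 + α) / 2)) := Real.rpow_pos_of_pos (by linarith) _
  have hmd : (d : ℝ) < 2 * m := by linarith
  have i1 := hw.integrable_kernelF_mul hm0 j h k x hs hτ
  have i2 := (hw.integrable hmd hs).const_mul (kernelF j h k x τ)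
  have i3 := hw.integrable_norm_mul hm hs
  have i4 := (integrable_kernelF j h k x hτ).abs
  have eL : Real.sqrt (1 + s) ^ (-(2 * m - (d : ℝ) - 1 - α)) =
      (1 + s) ^ (-(m - ((d : ℝ) + 1 + α) / 2)) := by
    rw [sqrt_rpow hs]; congr 1; ring
  set a := 2 * K₁ * τ ^ (-((1 - α) / 2)) with ha
  set b := B * P * (1 + s) ^ (-(m - ((d : ℝ) + 1 + α) / 2)) with hb
  have i5 : Integrable fun y => ‖x‖ ^ (-(d : ℝ) - 1 - α) *
      (a * (‖y‖ * |w s y|) + b * |kernelF j h k (x - y) τ|) :=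
    ((i3.const_mul a).add (i4.const_mul b)).const_mul _
  have e5 : ∫ y, ‖x‖ ^ (-(d : ℝ) - 1 - α) *
      (a * (‖y‖ * |w s y|) + b * |kernelF j h k (x - y) τ|) =
      ‖x‖ ^ (-(d : ℝ) - 1 - α) *
        (a * (∫ y, ‖y‖ * |w s y|) + b * ∫ y, |kernelF j h k (x - y) τ|) := by
    rw [integral_const_mul, integral_add (i3.const_mul a) (i4.const_mul b), integral_const_mul,
      integral_const_mul]
  rw [← integral_const_mul, ← integral_sub i1 i2, ← Real.norm_eq_abs]
  refine (norm_integral_le_of_norm_le i5 ?_).trans ?_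
  · filter_upwards [hw.bound s hs] with y hy
    rw [← sub_mul, Real.norm_eq_abs]
    have := abs_kernelF_sub_mul_le hα0 hα hK₁.le hB j h k hx hτ hl y hy
      (hb₁ j h k x hx τ hτ).1 ((hb₁ j h k x hx τ hτ).2 y)
    rwa [eL] at this
  · rw [e5, ha, hb]
    have j1 := hw.integral_norm_mul_le hm hs
    rw [← hI] at j1
    have j2 := hb₂ j h k x τ hτ
    calc _ ≤ ‖x‖ ^ (-(d : ℝ) - 1 - α) *
          (2 * K₁ * τ ^ (-((1 - α) / 2)) * (B * I * (1 + s) ^ (-(m - ((d : ℝ) + 1) / 2))) +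
            B * P * (1 + s) ^ (-(m - ((d : ℝ) + 1 + α) / 2)) * (K₂ * τ ^ (-(1 / 2 : ℝ)))) := by
          gcongr
      _ = B * ‖x‖ ^ (-(d : ℝ) - 1 - α) *
          ((2 * K₁ * I) * (τ ^ (-((1 - α) / 2)) * (1 + s) ^ (-(m - ((d : ℝ) + 1) / 2))) +
            (P * K₂) * (τ ^ (-(1 / 2 : ℝ)) * (1 + s) ^ (-(m - ((d : ℝ) + 1 + α) / 2)))) := by ring
      _ ≤ B * ‖x‖ ^ (-(d : ℝ) - 1 - α) *
          ((2 * K₁ * I + P * K₂) * (τ ^ (-((1 - α) / 2)) * (1 + s) ^ (-(m - ((d : ℝ) + 1) / 2))) +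
            (2 * K₁ * I + P * K₂) *
              (τ ^ (-(1 / 2 : ℝ)) * (1 + s) ^ (-(m - ((d : ℝ) + 1 + α) / 2)))) := by
          have h1 : 0 ≤ 2 * K₁ * I := mul_nonneg (by linarith) hI0
          have h2 : 0 ≤ P * K₂ := (mul_pos hP0 hK₂).le
          exact mul_le_mul_of_nonneg_left (add_le_add
            (mul_le_mul_of_nonneg_right (by linarith) (mul_pos hT hS).le)
            (mul_le_mul_of_nonneg_right (by linarith) (mul_pos hT' hS').le))
            (mul_nonneg hB hX.le)
      _ = _ := by ring

/-- The remainder estimate for one component. The exponent `p` is any one that dominates both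
time integrals. -/
lemma exists_abs_remainder_le (d : ℕ) {m α p : ℝ} (hm0 : 0 < m) (hm : (d : ℝ) + 1 < 2 * m)
    (hα0 : 0 ≤ α) (hα1 : α ≤ 1) (hα : (d : ℝ) + 1 + α ≤ 2 * m) (hp : -((1 - α) / 2) ≤ p)
    (hp' : ((d : ℝ) + 2 + α) / 2 - m < p) :
    ∃ K : ℝ, 0 < K ∧ ∀ (B : ℝ) (w : ℝ → Space d → ℝ), SpaceTimeDecay m B w →
      ∀ (j h k : Fin d) (x : Space d), x ≠ 0 → ∀ t : ℝ, 1 ≤ t →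
        |(∫ s in (0 : ℝ)..t, ∫ y, kernelF j h k (x - y) (t - s) * w s y) -
            ∫ s in (0 : ℝ)..t, kernelF j h k x (t - s) * ∫ y, w s y| ≤
          K * B * ‖x‖ ^ (-(d : ℝ) - 1 - α) * t ^ p := by
  obtain ⟨K, hK, hb⟩ := exists_abs_integral_kernelF_sub_le d hm0 hm hα0 hα1 hα
  have ha1 : (1 - α) / 2 < 1 := by linarith
  have ha2 : (1 / 2 : ℝ) < 1 := by norm_num
  obtain ⟨C₁, hC₁, hc₁⟩ := exists_integral_sub_rpow_mul_le (a := (1 - α) / 2)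
    (b := m - ((d : ℝ) + 1) / 2) (p := p) (by linarith) ha1 (by linarith) hp (by linarith)
  obtain ⟨C₂, hC₂, hc₂⟩ := exists_integral_sub_rpow_mul_le (a := 1 / 2)
    (b := m - ((d : ℝ) + 1 + α) / 2) (p := p) (by norm_num) ha2 (by linarith) (by linarith)
    (by linarith)
  refine ⟨K * (C₁ + C₂), by positivity, fun B w hw j h k x hx t ht => ?_⟩
  have hB := hw.nonneg
  have ht0 : (0 : ℝ) ≤ t := by linarith
  have hX : 0 ≤ ‖x‖ ^ (-(d : ℝ) - 1 - α) := Real.rpow_nonneg (norm_nonneg x) _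
  have hmd : (d : ℝ) < 2 * m := by linarith
  have i1 := intervalIntegrable_sub_rpow_mul ha1 (m - ((d : ℝ) + 1) / 2) ht0
  have i2 := intervalIntegrable_sub_rpow_mul ha2 (m - ((d : ℝ) + 1 + α) / 2) ht0
  rw [← intervalIntegral.integral_sub (hw.intervalIntegrable_integral_kernelF_mul hm0 j h k x ht0)
    (hw.intervalIntegrable_kernelF_mul_integral hm0 hmd j h k hx ht0), ← Real.norm_eq_abs]
  refine (intervalIntegral.norm_integral_le_of_norm_le ht0 ?_
    ((i1.add i2).const_mul (K * B * ‖x‖ ^ (-(d : ℝ) - 1 - α)))).trans ?_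
  · -- The kernel bounds need `t - s > 0`, which excludes the endpoint.
    have hne : ∀ᵐ s : ℝ, s ≠ t := by
      simp [ae_iff, measure_singleton]
    filter_upwards [hne] with s hst hs
    exact hb B w hw j h k x hx s (t - s) hs.1.le (sub_pos.2 (lt_of_le_of_ne hs.2 hst))
  · rw [intervalIntegral.integral_const_mul, intervalIntegral.integral_add i1 i2]
    calc _ ≤ K * B * ‖x‖ ^ (-(d : ℝ) - 1 - α) * (C₁ * t ^ p + C₂ * t ^ p) := by
          gcongr
          · exact hc₁ t ht
          · exact hc₂ t ht
      _ = _ := by ring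

end SpaceTimeDecay

/-! ### The asymptotic profile -/

lemma norm_le_mul_of_abs_apply_le {d : ℕ} {v : Space d} {M : ℝ} (hM : 0 ≤ M)
    (h : ∀ j, |v j| ≤ M) : ‖v‖ ≤ d * M := by
  rw [EuclideanSpace.norm_eq]
  refine Real.sqrt_le_iff.2 ⟨by positivity, ?_⟩
  calc ∑ j, ‖v j‖ ^ 2 ≤ ∑ _j : Fin d, M ^ 2 :=
        Finset.sum_le_sum fun j _ => pow_le_pow_left₀ (norm_nonneg _) (h j) 2
    _ = d * M ^ 2 := by simp
    _ ≤ (d : ℝ) ^ 2 * M ^ 2 := by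
        gcongr
        exact_mod_cast Nat.le_self_pow two_ne_zero d
    _ = _ := by ring

lemma abs_sum_sum_le {d : ℕ} {f : Fin d → Fin d → ℝ} {M : ℝ} (h : ∀ i j, |f i j| ≤ M) :
    |∑ i, ∑ j, f i j| ≤ (d : ℝ) ^ 2 * M := by
  calc _ ≤ ∑ i, ∑ j, |f i j| := (Finset.abs_sum_le_sum_abs _ _).trans
        (Finset.sum_le_sum fun i _ => Finset.abs_sum_le_sum_abs _ _)
    _ ≤ ∑ _i : Fin d, ∑ _j : Fin d, M :=
        Finset.sum_le_sum fun i _ => Finset.sum_le_sum fun j _ => h i j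
    _ = _ := by simp; ring

/-- The two extreme decay rates, in space and in time, combine to the decay of
`(√(1+s) + |y|)^{-m}`. -/
lemma sq_norm_le_of_decay {C₀ m s r n : ℝ} (hm : 0 ≤ m) (hs : 0 ≤ s) (hr : 0 ≤ r) (hn : 0 ≤ n)
    (h1 : n ≤ C₀ * (1 + r) ^ (-m)) (h2 : n ≤ C₀ * (1 + s) ^ (-m / 2)) :
    n ^ 2 ≤ C₀ ^ 2 * 2 ^ (2 * m) * (Real.sqrt (1 + s) + r) ^ (-(2 * m)) := by
  have hl : 0 < Real.sqrt (1 + s) := Real.sqrt_pos.2 (by linarith)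
  have hC : 0 ≤ C₀ := by
    have : 0 < (1 + r) ^ (-m) := by positivity
    exact nonneg_of_mul_nonneg_left (hn.trans h1) this
  set X := (Real.sqrt (1 + s) + r) / 2 with hX
  have hX0 : 0 < X := by positivity
  have key : n ≤ C₀ * X ^ (-m) := by
    rcases le_total (Real.sqrt (1 + s)) r with h | h
    · refine h1.trans (mul_le_mul_of_nonneg_left ?_ hC)
      exact Real.rpow_le_rpow_of_nonpos hX0 (by linarith) (by linarith)
    · have e : (1 + s) ^ (-m / 2) = Real.sqrt (1 + s) ^ (-m) := by
        rw [Real.sqrt_eq_rpow, ← Real.rpow_mul (by linarith)]; congr 1; ring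
      rw [e] at h2
      refine h2.trans (mul_le_mul_of_nonneg_left ?_ hC)
      exact Real.rpow_le_rpow_of_nonpos hX0 (by linarith) (by linarith)
  calc n ^ 2 ≤ (C₀ * X ^ (-m)) ^ 2 := pow_le_pow_left₀ hn key 2
    _ = C₀ ^ 2 * X ^ (-(2 * m)) := by
        rw [mul_pow, ← Real.rpow_natCast (X ^ (-m)), ← Real.rpow_mul hX0.le]
        congr 2; push_cast; ring
    _ = _ := by
        rw [hX, Real.div_rpow (by positivity) (by norm_num),
          Real.rpow_neg (by norm_num : (0 : ℝ) ≤ 2), div_inv_eq_mul]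
        ring

/-- The velocity field, continued to negative times by its initial value. A mild solution is
measurable on nonnegative times only, and its continuation is measurable on `ℝ × ℝ^d`. -/
def extend {d : ℕ} (u : ℝ → Space d → Space d) (s : ℝ) : Space d → Space d := u (max s 0)

lemma extend_of_nonneg {d : ℕ} (u : ℝ → Space d → Space d) {s : ℝ} (hs : 0 ≤ s) :
    extend u s = u s := by
  rw [extend, max_eq_left hs]

lemma measurable_extend {d : ℕ} {a : Space d → Space d} {u : ℝ → Space d → Space d}
    (hu : IsGlobalMildSolution a u) : Measurable fun p : ℝ × Space d => extend u p.1 p.2 := by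
  have h1 : Measurable fun p : ℝ × Space d => (p.1.toNNReal, p.2) := by fun_prop
  have h2 := hu.measurable.comp h1
  simpa only [extend, Function.comp_def, Real.coe_toNNReal'] using h2

lemma abs_mul_apply_le {d : ℕ} (v : Space d) (h k : Fin d) : |v h * v k| ≤ ‖v‖ ^ 2 := by
  rw [abs_mul, sq]
  gcongr <;> exact abs_coord_le_norm v _

lemma intervalIntegral_congr_extend {d : ℕ} (u : ℝ → Space d → Space d)
    (f : ℝ → (Space d → Space d) → ℝ) {t : ℝ} (ht : 0 ≤ t) :
    ∫ s in (0 : ℝ)..t, f s (u s) = ∫ s in (0 : ℝ)..t, f s (extend u s) := by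
  refine intervalIntegral.integral_congr fun s hs => ?_
  rw [Set.uIcc_of_le ht] at hs
  simp only [extend_of_nonneg u hs.1]

/-- Fields for which `|v|²`, and hence every product `v_h v_k`, has space-time decay. The products
are listed separately, as their measurability does not follow from that of `|v|²`. -/
structure FieldDecay {d : ℕ} (m B : ℝ) (v : ℝ → Space d → Space d) : Prop where
  normSq : SpaceTimeDecay m B fun s y => ‖v s y‖ ^ 2
  prod : ∀ h k, SpaceTimeDecay m B fun s y => v s y h * v s y k

lemma fieldDecay_extend {d : ℕ} {a : Space d → Space d} {u : ℝ → Space d → Space d}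
    (hu : IsGlobalMildSolution a u) {C₀ m : ℝ} (hm : 0 ≤ m)
    (hdec : ∀ α β : ℝ, 0 ≤ α → 0 ≤ β → α + β ≤ m → ∀ t : ℝ, 0 ≤ t → ∀ᵐ x : Space d,
      ‖u t x‖ ≤ C₀ * (1 + ‖x‖) ^ (-α) * (1 + t) ^ (-β / 2)) :
    FieldDecay m (C₀ ^ 2 * 2 ^ (2 * m)) (extend u) := by
  have hmeas := measurable_extend hu
  have hb (s : ℝ) (hs : 0 ≤ s) : ∀ᵐ y : Space d, ‖extend u s y‖ ^ 2 ≤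
      C₀ ^ 2 * 2 ^ (2 * m) * (Real.sqrt (1 + s) + ‖y‖) ^ (-(2 * m)) := by
    filter_upwards [hdec m 0 hm le_rfl (by simp) s hs, hdec 0 m le_rfl hm (by simp) s hs]
      with y h1 h2
    rw [extend_of_nonneg u hs]
    refine sq_norm_le_of_decay hm hs (norm_nonneg y) (norm_nonneg _) ?_ ?_
    · simpa using h1
    · simpa using h2
  have hcoord (h : Fin d) : Measurable fun p : ℝ × Space d => extend u p.1 p.2 h := by
    have := (EuclideanSpace.proj h : Space d →L[ℝ] ℝ).measurable.comp hmeas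
    simpa only [Function.comp_def, PiLp.proj_apply] using this
  refine ⟨⟨hmeas.norm.pow_const 2, fun s hs => ?_⟩, fun h k =>
    ⟨(hcoord h).mul (hcoord k), fun s hs => ?_⟩⟩
  · filter_upwards [hb s hs] with y hy
    rwa [abs_of_nonneg (by positivity)]
  · filter_upwards [hb s hs] with y hy
    exact (abs_mul_apply_le _ h k).trans hy

/-- The part of the solution which is Gaussian in `x/√(t+1)`: minus the time integral of the kernel
without its homogeneous part, against the space integrals of `v_h v_k`. -/
noncomputable def gaussianPart {d : ℕ} (v : ℝ → Space d → Space d) (j : Fin d) (x : Space d)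
    (t : ℝ) : ℝ :=
  -∑ h, ∑ k, ∫ s in (0 : ℝ)..t,
    (kernelF j h k x (t - s) - homKernel j h k x) * ∫ y, v s y h * v s y k

/-- The function `E` of the expansion, in the self-similar variable `z = x/√(t+1)`. At `z = 0`,
where `homKernel` is not the homogeneous part of the kernel, it is set to `0`. -/
noncomputable def profileE {d : ℕ} (v : ℝ → Space d → Space d) (z : Space d) (t : ℝ) : Space d :=
  WithLp.toLp 2 fun j => if z = 0 then 0 else
    ‖Real.sqrt (t + 1) • z‖ ^ ((d : ℝ) + 1) * gaussianPart v j (Real.sqrt (t + 1) • z) t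

lemma smul_profileE_apply {d : ℕ} (v : ℝ → Space d → Space d) {x : Space d} (hx : x ≠ 0) {t : ℝ}
    (ht : 0 < t) (j : Fin d) :
    (‖x‖ ^ (-(d : ℝ) - 1) • profileE v ((Real.sqrt (t + 1))⁻¹ • x) t) j = gaussianPart v j x t := by
  have hr : Real.sqrt (t + 1) ≠ 0 := (Real.sqrt_pos.2 (by linarith)).ne'
  have hn : 0 < ‖x‖ := norm_pos_iff.2 hx
  have hz : (Real.sqrt (t + 1))⁻¹ • x ≠ 0 := smul_ne_zero (inv_ne_zero hr) hx
  simp only [profileE, PiLp.smul_apply, smul_eq_mul, if_neg hz, smul_inv_smul₀ hr]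
  rw [← mul_assoc, ← Real.rpow_add hn]
  simp

/-- Splitting the kernel at `x` into its homogeneous and its Gaussian part. -/
lemma FieldDecay.gaussianPart_eq {d : ℕ} {m B : ℝ} {v : ℝ → Space d → Space d}
    (hv : FieldDecay m B v) (hm0 : 0 < m) (hm : (d : ℝ) < 2 * m) (j : Fin d) {x : Space d}
    (hx : x ≠ 0) {t : ℝ} (ht : 0 ≤ t) :
    gaussianPart v j x t = (∑ h, ∑ k, homKernel j h k x * energyMatrix v h k t) -
      ∑ h, ∑ k, ∫ s in (0 : ℝ)..t, kernelF j h k x (t - s) * ∫ y, v s y h * v s y k := by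
  rw [gaussianPart, ← Finset.sum_sub_distrib, ← Finset.sum_neg_distrib]
  refine Finset.sum_congr rfl fun h _ => ?_
  rw [← Finset.sum_sub_distrib, ← Finset.sum_neg_distrib]
  refine Finset.sum_congr rfl fun k _ => ?_
  have i1 := (hv.prod h k).intervalIntegrable_kernelF_mul_integral hm0 hm j h k hx ht
  have i2 := ((hv.prod h k).intervalIntegrable_integral hm0 hm ht).const_mul (homKernel j h k x)
  simp only [sub_mul]
  rw [intervalIntegral.integral_sub i1 i2, intervalIntegral.integral_const_mul, energyMatrix]
  ring

/-- The Gaussian bound for the profile. The time scales `t - s` of the kernel are all smaller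
than `t + 1`. -/
lemma exists_norm_profileE_le (d : ℕ) : ∃ C : ℝ, 0 < C ∧ ∀ (m B : ℝ) (v : ℝ → Space d → Space d),
    FieldDecay m B v → 0 < m → (d : ℝ) < 2 * m → ∀ (z : Space d) (t : ℝ), 0 < t →
      ‖profileE v z t‖ ≤ C * Real.exp (-(1 / 64) * ‖z‖ ^ 2) * spaceTimeNormSq v t := by
  obtain ⟨K, hK, hKb⟩ := exists_kernelF_sub_homKernel_bound d
  refine ⟨d * ((d : ℝ) ^ 2 * K) + 1, by positivity, fun m B v hv hm0 hm z t ht => ?_⟩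
  have hN : 0 ≤ spaceTimeNormSq v t :=
    intervalIntegral.integral_nonneg ht.le fun s _ => integral_nonneg fun y => by positivity
  set G := Real.exp (-(1 / 64) * ‖z‖ ^ 2) with hG
  have hG0 : 0 < G := Real.exp_pos _
  have main : ‖profileE v z t‖ ≤ d * ((d : ℝ) ^ 2 * K * G * spaceTimeNormSq v t) := by
    refine norm_le_mul_of_abs_apply_le (by positivity) fun j => ?_
    by_cases hz : z = 0
    · simp only [profileE, if_pos hz, abs_zero]
      positivity
    have hr : 0 < Real.sqrt (t + 1) := Real.sqrt_pos.2 (by linarith)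
    set x := Real.sqrt (t + 1) • z with hxdef
    have hx : x ≠ 0 := smul_ne_zero hr.ne' hz
    have hn : 0 < ‖x‖ := norm_pos_iff.2 hx
    have hx2 : 1 / 64 * ‖x‖ ^ 2 / (t + 1) = 1 / 64 * ‖z‖ ^ 2 := by
      rw [hxdef, norm_smul, Real.norm_of_nonneg hr.le, mul_pow, Real.sq_sqrt (by linarith)]
      field_simp
    have hX : 0 < ‖x‖ ^ (-(d : ℝ) - 1) := Real.rpow_pos_of_pos hn _
    have iN := (hv.normSq.intervalIntegrable_integral hm0 hm ht.le).const_mul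
      (K * ‖x‖ ^ (-(d : ℝ) - 1) * G)
    have hcomp (h k : Fin d) : |∫ s in (0 : ℝ)..t,
        (kernelF j h k x (t - s) - homKernel j h k x) * ∫ y, v s y h * v s y k| ≤
        K * ‖x‖ ^ (-(d : ℝ) - 1) * G * spaceTimeNormSq v t := by
      rw [spaceTimeNormSq, ← intervalIntegral.integral_const_mul, ← Real.norm_eq_abs]
      refine intervalIntegral.norm_integral_le_of_norm_le ht.le ?_ iN
      -- The kernel bounds need `t - s > 0`, which excludes the endpoint.
      have hne : ∀ᵐ s : ℝ, s ≠ t := by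
        simp [ae_iff, measure_singleton]
      filter_upwards [hne] with s hst hs
      have hτ : 0 < t - s := sub_pos.2 (lt_of_le_of_ne hs.2 hst)
      have b1 : |kernelF j h k x (t - s) - homKernel j h k x| ≤ K * ‖x‖ ^ (-(d : ℝ) - 1) * G := by
        refine (hKb j h k x hx (t - s) hτ).trans ?_
        have : Real.exp (-(1 / 64 * ‖x‖ ^ 2 / (t - s))) ≤ G := by
          rw [hG, neg_mul, ← hx2]
          refine Real.exp_le_exp.2 (neg_le_neg ?_)
          exact div_le_div_of_nonneg_left (by positivity) hτ (by linarith [hs.1])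
        gcongr
      have b2 : |∫ y, v s y h * v s y k| ≤ ∫ y, ‖v s y‖ ^ 2 := by
        rw [← Real.norm_eq_abs]
        exact norm_integral_le_of_norm_le (hv.normSq.integrable hm hs.1.le)
          (Filter.Eventually.of_forall fun y => abs_mul_apply_le _ h k)
      rw [norm_mul, Real.norm_eq_abs, Real.norm_eq_abs]
      gcongr
    simp only [profileE, if_neg hz]
    rw [gaussianPart, abs_mul, abs_neg, abs_of_nonneg (by positivity)]
    calc _ ≤ ‖x‖ ^ ((d : ℝ) + 1) *
          ((d : ℝ) ^ 2 * (K * ‖x‖ ^ (-(d : ℝ) - 1) * G * spaceTimeNormSq v t)) := by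
          gcongr
          exact abs_sum_sum_le hcomp
      _ = (‖x‖ ^ ((d : ℝ) + 1) * ‖x‖ ^ (-(d : ℝ) - 1)) *
          ((d : ℝ) ^ 2 * K * G * spaceTimeNormSq v t) := by ring
      _ = _ := by rw [← Real.rpow_add hn]; simp
  refine main.trans ?_
  have : 0 ≤ G * spaceTimeNormSq v t := by positivity
  linarith

/-- The components of the remainder: the error made by replacing `F(x-y)` by `F(x)` in the
integral equation. -/
lemma remainder_apply {d : ℕ} (hd : d ≠ 0) {a : Space d → Space d} {u : ℝ → Space d → Space d}
    (hu : IsGlobalMildSolution a u) {m B : ℝ} (hv : FieldDecay m B (extend u)) (hm0 : 0 < m)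
    (hm : (d : ℝ) < 2 * m) {t : ℝ} (ht : 0 < t) {x : Space d} (hx : x ≠ 0) (j : Fin d) :
    (u t x - heat t a x - gradient (fun y => potential u y t) x
        - ‖x‖ ^ (-(d : ℝ) - 1) • profileE (extend u) ((Real.sqrt (t + 1))⁻¹ • x) t) j =
      -∑ h, ∑ k, ((∫ s in (0 : ℝ)..t, ∫ y,
          kernelF j h k (x - y) (t - s) * (extend u s y h * extend u s y k)) -
        ∫ s in (0 : ℝ)..t, kernelF j h k x (t - s) * ∫ y, extend u s y h * extend u s y k) := by
  have e1 (h k : Fin d) : energyMatrix u h k t = energyMatrix (extend u) h k t :=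
    intervalIntegral_congr_extend u (fun _ v => ∫ y, v y h * v y k) ht.le
  have e2 (h k : Fin d) : (∫ s in (0 : ℝ)..t, ∫ y : Space d,
      kernelF j h k (x - y) (t - s) * (u s y h * u s y k)) = ∫ s in (0 : ℝ)..t, ∫ y,
      kernelF j h k (x - y) (t - s) * (extend u s y h * extend u s y k) :=
    intervalIntegral_congr_extend u
      (fun s v => ∫ y, kernelF j h k (x - y) (t - s) * (v y h * v y k)) ht.le
  rw [PiLp.sub_apply, PiLp.sub_apply, PiLp.sub_apply, smul_profileE_apply _ hx ht,
    gradient_potential hd u hx, hu.mild t ht x j, hv.gaussianPart_eq hm0 hm j hx ht.le]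
  simp only [e1, e2, Finset.sum_sub_distrib]
  ring

/-- The remainder estimate, for every exponent `p` that dominates the time integrals. -/
lemma exists_norm_remainder_le {d : ℕ} (hd : d ≠ 0) {m α p : ℝ} (hm0 : 0 < m)
    (hm : (d : ℝ) + 1 < 2 * m) (hα0 : 0 ≤ α) (hα1 : α ≤ 1) (hα : (d : ℝ) + 1 + α ≤ 2 * m)
    (hp : -((1 - α) / 2) ≤ p) (hp' : ((d : ℝ) + 2 + α) / 2 - m < p) (B : ℝ) :
    ∃ K : ℝ, ∀ (a : Space d → Space d) (u : ℝ → Space d → Space d),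
      IsGlobalMildSolution a u → FieldDecay m B (extend u) → ∀ t : ℝ, 1 ≤ t → ∀ x : Space d, x ≠ 0 →
        ‖u t x - heat t a x - gradient (fun y => potential u y t) x
          - ‖x‖ ^ (-(d : ℝ) - 1) • profileE (extend u) ((Real.sqrt (t + 1))⁻¹ • x) t‖ ≤
          K * ‖x‖ ^ (-(d : ℝ) - 1 - α) * t ^ p := by
  obtain ⟨K, hK, hb⟩ := SpaceTimeDecay.exists_abs_remainder_le d hm0 hm hα0 hα1 hα hp hp'
  refine ⟨d * ((d : ℝ) ^ 2 * (K * B)), fun a u hu hv t ht x hx => ?_⟩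
  have hB := hv.normSq.nonneg
  refine (norm_le_mul_of_abs_apply_le
    (M := (d : ℝ) ^ 2 * (K * B * ‖x‖ ^ (-(d : ℝ) - 1 - α) * t ^ p))
    (by have : (0 : ℝ) ≤ t := by linarith
        positivity) fun j => ?_).trans_eq (by ring)
  rw [remainder_apply hd hu hv hm0 (by linarith) (by linarith) hx, abs_neg]
  exact abs_sum_sum_le fun h k => hb B _ (hv.prod h k) j h k x hx t ht

end NSProfile

open NSProfile

theorem mainTheorem2 (d : ℕ) (hd : 2 ≤ d) :
    -- the constants of the Gaussian bound depend on `d` only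
    ∃ C c : ℝ, 0 < C ∧ 0 < c ∧
    ∀ ϑ C₀ : ℝ, ((d : ℝ) + 1) / 2 < ϑ →
    -- the constants of the remainder bounds depend on `d`, `ϑ`, `C₀`, `α` (and `ε`) only
    ∃ (C₁ : ℝ → ℝ) (C₂ : ℝ → ℝ → ℝ),
    ∀ (a : NSProfile.Space d → NSProfile.Space d) (u : ℝ → NSProfile.Space d → NSProfile.Space d),
      NSProfile.IsGlobalMildSolution a u →
      (∀ α β : ℝ, 0 ≤ α → 0 ≤ β → α + β ≤ min ϑ ((d : ℝ) + 1) →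
        ∀ t : ℝ, 0 ≤ t → ∀ᵐ x : NSProfile.Space d,
          ‖u t x‖ ≤ C₀ * (1 + ‖x‖) ^ (-α) * (1 + t) ^ (-β / 2)) →
      ∃ E R : NSProfile.Space d → ℝ → NSProfile.Space d,
        (∀ t : ℝ, 0 < t → ∀ x : NSProfile.Space d, x ≠ 0 →
          u t x = NSProfile.heat t a x + gradient (fun y => NSProfile.potential u y t) x
            + ‖x‖ ^ (-(d : ℝ) - 1) • E ((Real.sqrt (t + 1))⁻¹ • x) t + R x t) ∧
        (∀ t : ℝ, 0 < t → ∀ x : NSProfile.Space d,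
          ‖E x t‖ ≤ C * Real.exp (-c * ‖x‖ ^ 2) * NSProfile.spaceTimeNormSq u t) ∧
        (((d : ℝ) + 3) / 2 < ϑ →
          ∀ α : ℝ, 0 ≤ α → α ≤ min 1 (ϑ - ((d : ℝ) + 1) / 2) →
          ∀ t : ℝ, 1 ≤ t → ∀ x : NSProfile.Space d, x ≠ 0 →
            ‖R x t‖ ≤ C₁ α * ‖x‖ ^ (-(d : ℝ) - 1 - α) * t ^ (-(1 / 2 : ℝ) + α / 2)) ∧
        (ϑ ≤ ((d : ℝ) + 3) / 2 →
          ∀ α : ℝ, 0 ≤ α → α ≤ min 1 (ϑ - ((d : ℝ) + 1) / 2) →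
          ∀ ε : ℝ, 0 < ε →
          ∀ t : ℝ, 1 ≤ t → ∀ x : NSProfile.Space d, x ≠ 0 →
            ‖R x t‖ ≤ C₂ α ε * ‖x‖ ^ (-(d : ℝ) - 1 - α) *
              t ^ (((d : ℝ) + 2 + α) / 2 - ϑ + ε)) := by
  obtain ⟨C, hC, hE⟩ := exists_norm_profileE_le d
  refine ⟨C, 1 / 64, hC, by norm_num, fun ϑ C₀ hϑ => ?_⟩
  have hd0 : d ≠ 0 := by omega
  have hd2 : (2 : ℝ) ≤ d := by exact_mod_cast hd
  set m := min ϑ ((d : ℝ) + 1) with hmdef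
  have hm1 : ((d : ℝ) + 1) / 2 < m := lt_min hϑ (by linarith)
  have hm0 : 0 < m := by linarith
  have hm : (d : ℝ) + 1 < 2 * m := by linarith
  set B := C₀ ^ 2 * 2 ^ (2 * m) with hB
  have hα' (α : ℝ) (hα : α ≤ min 1 (ϑ - ((d : ℝ) + 1) / 2)) : α ≤ 1 ∧ (d : ℝ) + 1 + α ≤ 2 * m := by
    have h1 := hα.trans (min_le_left _ _)
    have h2 := hα.trans (min_le_right _ _)
    refine ⟨h1, ?_⟩
    have : ((d : ℝ) + 1 + α) / 2 ≤ m := le_min (by linarith) (by linarith)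
    linarith
  -- One choice of constants serves both regimes, which differ in the exponent of `t` only.
  have key (α p : ℝ) : ∃ K : ℝ, 0 ≤ α → α ≤ min 1 (ϑ - ((d : ℝ) + 1) / 2) →
      -((1 - α) / 2) ≤ p → ((d : ℝ) + 2 + α) / 2 - m < p →
      ∀ (a : Space d → Space d) (u : ℝ → Space d → Space d),
      IsGlobalMildSolution a u → FieldDecay m B (extend u) → ∀ t : ℝ, 1 ≤ t → ∀ x : Space d, x ≠ 0 →
        ‖u t x - heat t a x - gradient (fun y => potential u y t) x
          - ‖x‖ ^ (-(d : ℝ) - 1) • profileE (extend u) ((Real.sqrt (t + 1))⁻¹ • x) t‖ ≤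
          K * ‖x‖ ^ (-(d : ℝ) - 1 - α) * t ^ p := by
    by_cases h : 0 ≤ α ∧ α ≤ min 1 (ϑ - ((d : ℝ) + 1) / 2) ∧ -((1 - α) / 2) ≤ p ∧
      ((d : ℝ) + 2 + α) / 2 - m < p
    · obtain ⟨h0, h1, h2, h3⟩ := h
      obtain ⟨K, hK⟩ := exists_norm_remainder_le hd0 hm0 hm h0 (hα' α h1).1 (hα' α h1).2 h2 h3 B
      exact ⟨K, fun _ _ _ _ => hK⟩
    · exact ⟨0, fun h0 h1 h2 h3 => absurd ⟨h0, h1, h2, h3⟩ h⟩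
  choose K hK using key
  refine ⟨fun α => K α (-(1 / 2 : ℝ) + α / 2),
    fun α ε => K α (((d : ℝ) + 2 + α) / 2 - ϑ + ε), fun a u hu hdec => ?_⟩
  have hv : FieldDecay m B (extend u) := fieldDecay_extend hu hm0.le hdec
  refine ⟨profileE (extend u), fun x t => u t x - heat t a x
    - gradient (fun y => potential u y t) x
    - ‖x‖ ^ (-(d : ℝ) - 1) • profileE (extend u) ((Real.sqrt (t + 1))⁻¹ • x) t,
    fun t _ x _ => by simp only [sub_sub]; exact (add_sub_cancel _ _).symm,
    fun t ht x => ?_, fun hϑ' α hα0 hα t ht x hx => ?_,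
    fun hϑ' α hα0 hα ε hε t ht x hx => ?_⟩
  · have e : spaceTimeNormSq u t = spaceTimeNormSq (extend u) t :=
      intervalIntegral_congr_extend u (fun _ v => ∫ y, ‖v y‖ ^ 2) ht.le
    rw [e]
    exact hE m B _ hv hm0 (by linarith) x t ht
  · have hm3 : ((d : ℝ) + 3) / 2 < m := lt_min hϑ' (by linarith)
    exact hK α _ hα0 hα (by linarith) (by linarith) a u hu hv t ht x hx
  · have hmϑ : m = ϑ := min_eq_left (by linarith)
    exact hK α _ hα0 hα (by linarith) (by linarith) a u hu hv t ht x hx
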